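/- Let $k$ be a field and let $Q$ be a finite quiver with set of vertices $Q_0$, set of arrows $Q_1$ and source and target maps $s,t\colon Q_1\to Q_0$. Let $kQ$ be its quiver algebra, that is the vector space with basis all oriented paths (including the trivial path at each vertex), where the product $pq$ of two paths is their concatenation "first $q$, then $p$" if it is possible, and $0$ otherwise; thus each arrow $a$ satisfies $a=t(a)\,a\,s(a)$. Let $F$ be the two-sided ideal of $kQ$ generated by $Q_1$, let $I$ be an admissible two-sided ideal of $kQ$, that is $F^n\subseteq I\subseteq F^2$ for some $n\ge 2$, and let $\Lambda=kQ/I$ be the resulting bound quiver algebra, which is finite dimensional. Let $Z\Lambda$ be the center of $\Lambda$. Consider $\Lambda$ as a $\Lambda$-bimodule, that is as a left module over the enveloping algebra $\Lambda^e=\Lambda\otimes_k\Lambda^{\mathrm{op}}$. Then $\Lambda$ has a minimal projective presentation $P_1\xrightarrow{d_1}P_0\xrightarrow{d_0}\Lambda\to 0$, where $P_0,P_1$ are finitely generated projective left $\Lambda^e$-modules and the surjections $P_0\to\Lambda$ and $P_1\to\operatorname{Ker}d_0$ are projective covers. For any such presentation, let $\operatorname{Tr}\Lambda=\operatorname{Coker}\bigl(\operatorname{Hom}_{\Lambda^e}(P_0,\Lambda^e)\xrightarrow{\,d_1^*\,}\operatorname{Hom}_{\Lambda^e}(P_1,\Lambda^e)\bigr)$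 be the transpose, let $\tau\Lambda=D\operatorname{Tr}\Lambda$ be the Auslander-Reiten translate, where $D=\operatorname{Hom}_k(-,k)$, and let $$\tau\text{-}HH^1(\Lambda)=D\operatorname{Hom}_{\Lambda^e}(\Lambda,\tau\Lambda)$$ be the first $\tau$-Hochschild cohomology of $\Lambda$. Then this vector space is finite dimensional and $$\dim_k \tau\text{-}HH^1(\Lambda)=\dim_k Z\Lambda-\sum_{x\in Q_0}\dim_k x\Lambda x+\sum_{a\in Q_1}\dim_k t(a)\Lambda s(a).$$ -/

import Mathlib

open scoped TensorProduct

/-! ### The path algebra of a finite quiver -/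

section PathAlgebra

universe u v w

/-- Oriented paths of a quiver, of length `≥ 0`, together with their source and target. -/
structure OrientedPath (V : Type v) [Quiver.{w} V] where
  source : V
  target : V
  path : Quiver.Path source target

namespace OrientedPath

variable {V : Type v} [Quiver.{w} V]

/-- The trivial path at the vertex `x`. -/
def trivial (x : V) : OrientedPath V := ⟨x, x, Quiver.Path.nil⟩

/-- An arrow, seen as a path of length one. -/
def ofArrow {x y : V} (a : x ⟶ y) : OrientedPath V := ⟨x, y, a.toPath⟩

open Classical in
/-- The concatenation `p q` ("first `q`, then `p`"), defined when the target of `q` is the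
source of `p`. -/
noncomputable def comp (p q : OrientedPath V) : Option (OrientedPath V) :=
  if h : q.target = p.source then
    some ⟨q.source, p.target, (q.path.cast rfl h).comp p.path⟩
  else none

theorem comp_assoc (p q r : OrientedPath V) :
    (comp p q).bind (fun m => comp m r) = (comp q r).bind (fun m => comp p m) := by
  obtain ⟨ps, pt, p⟩ := p
  obtain ⟨qs, qt, q⟩ := q
  obtain ⟨rs, rt, r⟩ := r
  by_cases h₁ : qt = ps
  · subst h₁
    by_cases h₂ : rt = qs
    · subst h₂
      simp [comp, Quiver.Path.comp_assoc]
    · simp [comp, h₂]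
  · by_cases h₂ : rt = qs
    · subst h₂
      simp [comp, h₁]
    · simp [comp, h₁, h₂]

theorem trivial_comp (x : V) (p : OrientedPath V) [Decidable (p.target = x)] :
    comp (trivial x) p = if p.target = x then some p else none := by
  obtain ⟨ps, pt, p⟩ := p
  by_cases h : pt = x
  · subst h
    simp [comp, trivial]
  · simp [comp, trivial, h]

theorem comp_trivial (x : V) (p : OrientedPath V) [Decidable (x = p.source)] :
    comp p (trivial x) = if x = p.source then some p else none := by
  obtain ⟨ps, pt, p⟩ := p
  by_cases h : x = ps
  · subst h
    simp [comp, trivial]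
  · simp [comp, trivial, h]

end OrientedPath

/-- The quiver algebra `kQ`: the vector space with basis the set of all oriented paths. -/
def PathAlgebra (k : Type u) [Field k] (V : Type v) [Quiver.{w} V] : Type max u v w :=
  OrientedPath V →₀ k

namespace PathAlgebra

variable {k : Type u} [Field k] {V : Type v} [Quiver.{w} V]

noncomputable instance : AddCommGroup (PathAlgebra k V) :=
  inferInstanceAs (AddCommGroup (OrientedPath V →₀ k))

noncomputable instance : Module k (PathAlgebra k V) :=
  inferInstanceAs (Module k (OrientedPath V →₀ k))

/-- The basis element of `kQ` given by an oriented path. -/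
noncomputable def ofPath (p : OrientedPath V) : PathAlgebra k V :=
  Finsupp.single p (1 : k)

/-- The set of oriented paths is a basis of `kQ`. -/
noncomputable def pathBasis : Module.Basis (OrientedPath V) k (PathAlgebra k V) :=
  Module.Basis.ofRepr (LinearEquiv.refl k (OrientedPath V →₀ k))

theorem pathBasis_apply (p : OrientedPath V) :
    (pathBasis p : PathAlgebra k V) = ofPath p := rfl

/-- The bilinear product of `kQ`: on paths it is the concatenation if it is possible,
and `0` otherwise. -/
noncomputable def mulLinear : PathAlgebra k V →ₗ[k] PathAlgebra k V →ₗ[k] PathAlgebra k V :=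
  pathBasis.constr k fun p => pathBasis.constr k fun q =>
    (OrientedPath.comp p q).elim 0 ofPath

noncomputable instance : Mul (PathAlgebra k V) := ⟨fun f g => mulLinear f g⟩

theorem mul_def (f g : PathAlgebra k V) : f * g = mulLinear f g := rfl

theorem ofPath_mul_ofPath (p q : OrientedPath V) :
    (ofPath p * ofPath q : PathAlgebra k V) = (OrientedPath.comp p q).elim 0 ofPath := by
  rw [mul_def, ← pathBasis_apply p, ← pathBasis_apply q, mulLinear]
  simp only [Module.Basis.constr_basis]

theorem ofPath_mul_ofPath_mul_ofPath (p q r : OrientedPath V) :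
    (ofPath p * ofPath q * ofPath r : PathAlgebra k V) = ofPath p * (ofPath q * ofPath r) := by
  have h := OrientedPath.comp_assoc p q r
  rw [ofPath_mul_ofPath, ofPath_mul_ofPath]
  cases h₁ : OrientedPath.comp p q <;> cases h₂ : OrientedPath.comp q r <;>
    simp only [h₁, h₂, Option.bind_none, Option.bind_some, Option.elim_none,
      Option.elim_some] at h ⊢
  · simp [mul_def]
  · rw [ofPath_mul_ofPath, ← h]
    simp [mul_def]
  · rw [ofPath_mul_ofPath, h]
    simp [mul_def]
  · rw [ofPath_mul_ofPath, ofPath_mul_ofPath, h]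

theorem induction_on {motive : PathAlgebra k V → Prop} (f : PathAlgebra k V)
    (path : ∀ p, motive (ofPath p)) (zero : motive 0)
    (add : ∀ f g, motive f → motive g → motive (f + g))
    (smul : ∀ (c : k) f, motive f → motive (c • f)) : motive f := by
  have hf : f ∈ Submodule.span k (Set.range (pathBasis (k := k) (V := V))) := by
    rw [Module.Basis.span_eq]
    exact Submodule.mem_top
  induction hf using Submodule.span_induction with
  | mem x hx =>
    obtain ⟨p, rfl⟩ := hx
    exact path p
  | zero => exact zero
  | add x y _ _ hx hy => exact add x y hx hy
  | smul c x _ hx => exact smul c x hx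

noncomputable instance instNonUnitalRing : NonUnitalRing (PathAlgebra k V) where
  left_distrib f g h := by simp [mul_def]
  right_distrib f g h := by simp [mul_def]
  zero_mul f := by simp [mul_def]
  mul_zero f := by simp [mul_def]
  mul_assoc f g h := by
    induction f using induction_on with
    | zero => simp [mul_def]
    | add f f' hf hf' => simp only [mul_def, map_add, LinearMap.add_apply] at *; rw [hf, hf']
    | smul c f hf => simp only [mul_def, map_smul, LinearMap.smul_apply] at *; rw [hf]
    | path p =>
      induction g using induction_on with
      | zero => simp [mul_def]
      | add f f' hf hf' => simp only [mul_def, map_add, LinearMap.add_apply] at *; rw [hf, hf']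
      | smul c f hf => simp only [mul_def, map_smul, LinearMap.smul_apply] at *; rw [hf]
      | path q =>
        induction h using induction_on with
        | zero => simp [mul_def]
        | add f f' hf hf' => simp only [mul_def, map_add] at *; rw [hf, hf']
        | smul c f hf => simp only [mul_def, map_smul] at *; rw [hf]
        | path r => exact ofPath_mul_ofPath_mul_ofPath p q r

/-- The idempotent of `kQ` given by the vertex `x`. -/
noncomputable def vertex (x : V) : PathAlgebra k V := ofPath (OrientedPath.trivial x)

/-- The element of `kQ` given by the arrow `a`. -/
noncomputable def arrow {x y : V} (a : x ⟶ y) : PathAlgebra k V := ofPath (OrientedPath.ofArrow a)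

variable [Fintype V]

/-- The unit of `kQ` is the sum of the vertices. -/
noncomputable instance : One (PathAlgebra k V) := ⟨∑ x : V, vertex x⟩

theorem one_def : (1 : PathAlgebra k V) = ∑ x : V, vertex x := rfl

noncomputable instance : Ring (PathAlgebra k V) where
  __ := instNonUnitalRing
  one_mul f := by
    classical
    induction f using induction_on with
    | zero => exact mul_zero (1 : PathAlgebra k V)
    | add f f' hf hf' => exact (mul_add (1 : PathAlgebra k V) f f').trans (by rw [hf, hf'])
    | smul c f hf =>
      change mulLinear 1 f = f at hf
      change mulLinear 1 (c • f) = c • f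
      rw [map_smul, hf]
    | path p =>
      change (∑ x : V, vertex x) * ofPath p = ofPath p
      rw [Finset.sum_mul, Finset.sum_eq_single p.target]
      · simp [vertex, ofPath_mul_ofPath, OrientedPath.trivial_comp]
      · intro x _ hx
        simp [vertex, ofPath_mul_ofPath, OrientedPath.trivial_comp, Ne.symm hx]
      · simp
  mul_one f := by
    classical
    induction f using induction_on with
    | zero => exact zero_mul (1 : PathAlgebra k V)
    | add f f' hf hf' => exact (add_mul f f' (1 : PathAlgebra k V)).trans (by rw [hf, hf'])
    | smul c f hf =>
      change mulLinear f 1 = f at hf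
      change mulLinear (c • f) 1 = c • f
      rw [map_smul, LinearMap.smul_apply, hf]
    | path p =>
      change ofPath p * (∑ x : V, vertex x) = ofPath p
      rw [Finset.mul_sum, Finset.sum_eq_single p.source]
      · simp [vertex, ofPath_mul_ofPath, OrientedPath.comp_trivial]
      · intro x _ hx
        simp [vertex, ofPath_mul_ofPath, OrientedPath.comp_trivial, hx]
      · simp

noncomputable instance : Algebra k (PathAlgebra k V) :=
  Algebra.ofModule
    (fun c f g => by
      change mulLinear (c • f) g = c • mulLinear f g
      rw [map_smul, LinearMap.smul_apply])
    (fun c f g => by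
      change mulLinear f (c • g) = c • mulLinear f g
      rw [map_smul])

/-- The two-sided ideal `F` of `kQ` generated by the arrows. -/
noncomputable def arrowIdeal (k : Type u) [Field k] (V : Type v) [Quiver.{w} V] [Fintype V] :
    Ideal (PathAlgebra k V) :=
  (TwoSidedIdeal.span {f | ∃ (x y : V) (a : x ⟶ y), f = arrow a}).asIdeal

/-- A two-sided ideal `I` of `kQ` is admissible if `F ^ n ⊆ I ⊆ F ^ 2` for some `n ≥ 2`. -/
def IsAdmissible (I : Ideal (PathAlgebra k V)) [I.IsTwoSided] : Prop :=
  ∃ n : ℕ, 2 ≤ n ∧ arrowIdeal k V ^ n ≤ I ∧ I ≤ arrowIdeal k V ^ 2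

end PathAlgebra

end PathAlgebra

/-! ### Projective presentations, transpose, Auslander-Reiten translation -/

section AuslanderReiten

universe u a m p

/-- A submodule `N` of `M` is superfluous if `N + K = M` forces `K = M`. A surjection whose kernel
is superfluous is an essential epimorphism. -/
def Submodule.IsSuperfluous {A : Type a} [Ring A] {M : Type m} [AddCommGroup M] [Module A M]
    (N : Submodule A M) : Prop :=
  ∀ K : Submodule A M, N ⊔ K = ⊤ → K = ⊤

/-- A minimal projective presentation `P₁ → P₀ → M → 0` by finitely generated projective left
modules: `P₀ → M` and `P₁ → Ker (P₀ → M)` are projective covers. -/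
structure MinimalProjectivePresentation (A : Type a) [Ring A] (M : Type m) [AddCommGroup M]
    [Module A M] where
  P₁ : Type p
  P₀ : Type p
  [addCommGroup₁ : AddCommGroup P₁]
  [addCommGroup₀ : AddCommGroup P₀]
  [module₁ : Module A P₁]
  [module₀ : Module A P₀]
  finite₁ : Module.Finite A P₁
  finite₀ : Module.Finite A P₀
  projective₁ : Module.Projective A P₁
  projective₀ : Module.Projective A P₀
  d₁ : P₁ →ₗ[A] P₀
  d₀ : P₀ →ₗ[A] M
  surjective : Function.Surjective d₀
  exact : Function.Exact d₁ d₀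
  superfluous₀ : d₀.ker.IsSuperfluous
  superfluous₁ : d₁.ker.IsSuperfluous

attribute [instance] MinimalProjectivePresentation.addCommGroup₁
attribute [instance] MinimalProjectivePresentation.addCommGroup₀
attribute [instance] MinimalProjectivePresentation.module₁
attribute [instance] MinimalProjectivePresentation.module₀

/-- The right `A`-linear map `d^* : Hom_A(P₀, A) → Hom_A(P₁, A)` given by `d : P₁ → P₀`. Right
`A`-modules are `Aᵐᵒᵖ`-modules, and `(f a)(x) = f(x) a` for `f` in `Hom_A(P, A)`. -/
def homDual {A : Type a} [Ring A] {P₁ P₀ : Type p} [AddCommGroup P₁] [AddCommGroup P₀]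
    [Module A P₁] [Module A P₀] (d : P₁ →ₗ[A] P₀) : (P₀ →ₗ[A] A) →ₗ[Aᵐᵒᵖ] (P₁ →ₗ[A] A) where
  toFun f := f ∘ₗ d
  map_add' _ _ := rfl
  map_smul' _ _ := rfl

/-- The transpose `Tr M = Coker d₁^*`, a right `A`-module. -/
abbrev Transpose {A : Type a} [Ring A] {M : Type m} [AddCommGroup M] [Module A M]
    (Pr : MinimalProjectivePresentation.{a, m, p} A M) : Type (max a p) :=
  (Pr.P₁ →ₗ[A] A) ⧸ (homDual Pr.d₁).range

/-- The vector space dual `D X = Hom_k(X, k)` of a right `A`-module `X`. -/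
def VectorDual (k : Type u) [Field k] (X : Type m) [AddCommGroup X] [Module k X] : Type (max m u) :=
  X →ₗ[k] k

namespace VectorDual

variable (k : Type u) [Field k] (A : Type a) [Ring A] [Algebra k A]
  (X : Type m) [AddCommGroup X] [Module k X]

noncomputable instance : AddCommGroup (VectorDual k X) :=
  inferInstanceAs (AddCommGroup (X →ₗ[k] k))

/-- An element of `D X`, seen as a linear form. -/
def toLinearMap {k : Type u} [Field k] {X : Type m} [AddCommGroup X] [Module k X]
    (φ : VectorDual k X) : X →ₗ[k] k := φ

section

variable [Module Aᵐᵒᵖ X] [IsScalarTower k Aᵐᵒᵖ X]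

/-- The left action `(a φ)(x) = φ(x a)` of `A` on `D X`. -/
noncomputable instance instModuleLeft : Module A (VectorDual k X) where
  smul a φ := φ.toLinearMap ∘ₗ Algebra.lsmul k k X (MulOpposite.op a)
  one_smul φ := LinearMap.ext fun x => congrArg φ.toLinearMap (one_smul Aᵐᵒᵖ x)
  mul_smul a b φ := LinearMap.ext fun x => congrArg φ.toLinearMap
    (mul_smul (MulOpposite.op b) (MulOpposite.op a) x)
  smul_zero _ := rfl
  smul_add _ _ _ := rfl
  add_smul a b φ := LinearMap.ext fun x =>
    (congrArg φ.toLinearMap (add_smul (MulOpposite.op a) (MulOpposite.op b) x)).trans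
      (map_add φ.toLinearMap _ _)
  zero_smul φ := LinearMap.ext fun x =>
    (congrArg φ.toLinearMap (zero_smul Aᵐᵒᵖ x)).trans (map_zero φ.toLinearMap)

theorem smul_apply (a : A) (φ : VectorDual k X) (x : X) :
    (a • φ).toLinearMap x = φ.toLinearMap (MulOpposite.op a • x) := rfl

end

noncomputable instance instModule : Module k (VectorDual k X) :=
  inferInstanceAs (Module k (X →ₗ[k] k))

instance [Module Aᵐᵒᵖ X] [IsScalarTower k Aᵐᵒᵖ X] : SMulCommClass A k (VectorDual k X) where
  smul_comm _ _ _ := rfl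

end VectorDual

/-- The Auslander-Reiten translation `τ M = D Tr M`, a left `A`-module. -/
abbrev AuslanderReitenTranslate (k : Type u) [Field k] {A : Type a} [Ring A] [Algebra k A]
    {M : Type m} [AddCommGroup M] [Module A M]
    (Pr : MinimalProjectivePresentation.{a, m, p} A M) : Type (max a p u) :=
  VectorDual k (Transpose Pr)

end AuslanderReiten

/-! ### First `τ`-Hochschild cohomology -/

section Hochschild

universe u l m p

/-- The enveloping algebra `Λ^e = Λ ⊗ Λ^op`. Its left modules are the `Λ`-bimodules. -/
abbrev EnvelopingAlgebra (k : Type u) [Field k] (Λ : Type l) [Ring Λ] [Algebra k Λ] : Type l :=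
  Λ ⊗[k] Λᵐᵒᵖ

/-- The algebra `Λ` as a `Λ`-bimodule: `(a ⊗ b) x = a x b`. -/
noncomputable instance EnvelopingAlgebra.instModuleSelf (k : Type u) [Field k] (Λ : Type l) [Ring Λ]
    [Algebra k Λ] : Module (EnvelopingAlgebra k Λ) Λ :=
  instModuleTensorProductMop k Λ

theorem EnvelopingAlgebra.tmul_smul (k : Type u) [Field k] (Λ : Type l) [Ring Λ]
    [Algebra k Λ] (a b x : Λ) :
    (a ⊗ₜ[k] MulOpposite.op b : EnvelopingAlgebra k Λ) • x = a * x * b :=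
  AlgHom.mulLeftRight_apply k Λ a (MulOpposite.op b) x

/-- The first `τ`-Hochschild cohomology `HH¹_τ(Λ, X) = D Hom_{Λ-Λ}(X, τ Λ)` with coefficients in a
`Λ`-bimodule `X`, where `τ Λ` is computed from the minimal projective presentation `Pr` of the
`Λ`-bimodule `Λ`. -/
abbrev TauHochschild (k : Type u) [Field k] (Λ : Type l) [Ring Λ] [Algebra k Λ]
    (Pr : MinimalProjectivePresentation.{l, l, p} (EnvelopingAlgebra k Λ) Λ)
    (X : Type m) [AddCommGroup X] [Module (EnvelopingAlgebra k Λ) X] : Type _ :=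
  Module.Dual k (X →ₗ[EnvelopingAlgebra k Λ] AuslanderReitenTranslate k Pr)

/-- The subspace `e Λ f` of `Λ`. -/
def cornerSubspace (k : Type u) [Field k] {Λ : Type l} [Ring Λ] [Algebra k Λ] (e f : Λ) : Submodule k Λ :=
  (LinearMap.mulLeftRight k (e, f)).range

end Hochschild

section BoundQuiver

universe u v w

/-- The quotient algebra `kQ / I`. It is a bound quiver algebra when `I` is admissible. -/
abbrev BoundQuiverAlgebra (k : Type u) [Field k] (V : Type v) [Quiver.{w} V] [Fintype V]
    (I : Ideal (PathAlgebra k V)) : Type (max u v w) :=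
  PathAlgebra k V ⧸ I

/-- The image in `kQ / I` of the idempotent given by the vertex `x`. -/
noncomputable def BoundQuiverAlgebra.vertex {k : Type u} [Field k] {V : Type v} [Quiver.{w} V]
    [Fintype V] (I : Ideal (PathAlgebra k V)) [I.IsTwoSided] (x : V) :
    BoundQuiverAlgebra k V I :=
  Ideal.Quotient.mk I (PathAlgebra.vertex x)

end BoundQuiver

universe u v w p

/-!
Let `A = Λ^e` and let `P₁ → P₀ → Λ → 0` be a minimal projective presentation of the bimodule `Λ`.

For any `A`-module `X`, the space `Hom_A(X, τ Λ)` is the dual of the cokernel of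
`Hom_A(P₀, X) → Hom_A(P₁, X)` (`tauHomEquiv`): a linear form `φ` vanishing on the image corresponds
to the homomorphism sending `x` to the form `f ↦ φ (y ↦ f(y) x)` on `Tr Λ`, and the coordinates of
the finitely generated projective module `P₁` give the inverse. The kernel of the same map is
`Hom_A(Λ, X)`. For `X = Λ` the kernel is the center, so the dimension of `τ-HH¹(Λ)` is
`dim ZΛ - dim Hom_A(P₀, Λ) + dim Hom_A(P₁, Λ)` (`finrank_tauHom`).

Projective covers are unique, so it remains to compute these two spaces for one minimal
presentation. It is `P₀ = ⨁ x, Λx ⊗ xΛ` and `P₁ = ⨁ a, Λt(a) ⊗ s(a)Λ`, where `P₀ → Λ` is the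
multiplication and `P₁ → P₀` sends `t(a) ⊗ s(a)` to `a ⊗ s(a) - t(a) ⊗ a`. Since
`Hom_A(Ae, X) = eX` for an idempotent `e`, the two dimensions are the sums in the formula.

Exactness at `P₀` holds because the relations `a ⊗ s(a) = t(a) ⊗ a` allow one to move all arrows
to the left factor (`BoundQuiverStructure.sub_splitting_mem`). For minimality, let `r` be the ideal
of `Λ` generated by the arrows, which is nilpotent as `F ^ n ⊆ I`. By Nakayama's lemma it is enough
that both kernels lie in `r P + P r`. An element of `P₀` or `P₁` is, modulo this subspace, a
combination of the generators `x ⊗ x` or `t(a) ⊗ s(a)`, and its coefficients can be read off from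
its image: those in `P₀` because the vertices are linearly independent modulo `r`, and those in
`P₁` because the arrows are linearly independent modulo `r ^ 2`, which is where `I ⊆ F ^ 2`
enters (`isSuperfluous_ker_d₀`, `isSuperfluous_ker_d₁`).
-/

/-! ### Projective covers -/

section ProjectiveCover

universe a m q

variable {A : Type a} [Ring A]

/-- Projective covers of the same module are isomorphic over that module. -/
theorem exists_linearEquiv_of_isSuperfluous_ker {M : Type m} [AddCommGroup M] [Module A M]
    {P : Type p} [AddCommGroup P] [Module A P] [Module.Projective A P]
    {P' : Type q} [AddCommGroup P'] [Module A P'] [Module.Projective A P']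
    (f : P →ₗ[A] M) (f' : P' →ₗ[A] M) (hf : Function.Surjective f)
    (hf' : Function.Surjective f') (hk : f.ker.IsSuperfluous) (hk' : f'.ker.IsSuperfluous) :
    ∃ g : P ≃ₗ[A] P', ∀ x, f' (g x) = f x := by
  obtain ⟨g, hg⟩ := Module.projective_lifting_property f' f hf'
  have hg' : ∀ x, f' (g x) = f x := fun x => LinearMap.congr_fun hg x
  have hgs : Function.Surjective g := by
    rw [← LinearMap.range_eq_top]
    refine hk' _ (eq_top_iff.2 fun y _ => ?_)
    obtain ⟨x, hx⟩ := hf (f' y)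
    refine Submodule.mem_sup.2 ⟨y - g x, ?_, g x, ⟨x, rfl⟩, sub_add_cancel _ _⟩
    rw [LinearMap.mem_ker, map_sub, hg', hx, sub_self]
  -- `g` splits because `P'` is projective, and the section is again surjective.
  obtain ⟨h, hh⟩ := Module.projective_lifting_property g LinearMap.id hgs
  have hh' : ∀ y, g (h y) = y := fun y => LinearMap.congr_fun hh y
  have hhs : Function.Surjective h := by
    rw [← LinearMap.range_eq_top]
    refine hk _ (eq_top_iff.2 fun x _ => ?_)
    refine Submodule.mem_sup.2 ⟨x - h (g x), ?_, h (g x), ⟨g x, rfl⟩, sub_add_cancel _ _⟩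
    rw [LinearMap.mem_ker, map_sub, ← hg' (h (g x)), hh', hg', sub_self]
  refine ⟨LinearEquiv.ofBijective g ⟨fun x y hxy => ?_, hgs⟩, hg'⟩
  obtain ⟨x, rfl⟩ := hhs x
  obtain ⟨y, rfl⟩ := hhs y
  rw [hh', hh'] at hxy
  rw [hxy]

namespace MinimalProjectivePresentation

variable {M : Type m} [AddCommGroup M] [Module A M]

/-- The projective cover `P₁ → Ker d₀` of a minimal projective presentation. -/
def toKer (Pr : MinimalProjectivePresentation.{a, m, p} A M) : Pr.P₁ →ₗ[A] Pr.d₀.ker :=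
  Pr.d₁.codRestrict Pr.d₀.ker fun x => (Pr.exact _).2 ⟨x, rfl⟩

theorem toKer_surjective (Pr : MinimalProjectivePresentation.{a, m, p} A M) :
    Function.Surjective Pr.toKer := by
  rintro ⟨y, hy⟩
  obtain ⟨x, rfl⟩ := (Pr.exact y).1 hy
  exact ⟨x, rfl⟩

theorem ker_toKer (Pr : MinimalProjectivePresentation.{a, m, p} A M) :
    Pr.toKer.ker = Pr.d₁.ker :=
  LinearMap.ker_codRestrict _ _ _

/-- Minimal projective presentations of the same module have isomorphic terms. -/
theorem nonempty_linearEquiv (Pr : MinimalProjectivePresentation.{a, m, p} A M)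
    (Pr' : MinimalProjectivePresentation.{a, m, q} A M) :
    Nonempty (Pr.P₁ ≃ₗ[A] Pr'.P₁) ∧ Nonempty (Pr.P₀ ≃ₗ[A] Pr'.P₀) := by
  have := Pr.projective₀
  have := Pr.projective₁
  have := Pr'.projective₀
  have := Pr'.projective₁
  obtain ⟨g, hg⟩ := exists_linearEquiv_of_isSuperfluous_ker Pr.d₀ Pr'.d₀ Pr.surjective
    Pr'.surjective Pr.superfluous₀ Pr'.superfluous₀
  let r : Pr.d₀.ker →ₗ[A] Pr'.d₀.ker := (g : Pr.P₀ →ₗ[A] Pr'.P₀).restrict fun x hx => by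
    rw [LinearMap.mem_ker] at hx ⊢
    exact (hg x).trans hx
  have hr : Function.Bijective r := by
    refine ⟨fun x y hxy => Subtype.ext (g.injective (congrArg Subtype.val hxy)), fun y => ?_⟩
    refine ⟨⟨g.symm y, ?_⟩, Subtype.ext (g.apply_symm_apply y)⟩
    rw [LinearMap.mem_ker, ← hg, g.apply_symm_apply]
    exact y.2
  have hker : (r ∘ₗ Pr.toKer).ker = Pr.d₁.ker := by
    rw [LinearMap.ker_comp_of_ker_eq_bot _ (LinearMap.ker_eq_bot.2 hr.1), ker_toKer]
  obtain ⟨g₁, -⟩ := exists_linearEquiv_of_isSuperfluous_ker (r ∘ₗ Pr.toKer) Pr'.toKer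
    (hr.2.comp Pr.toKer_surjective) Pr'.toKer_surjective
    (hker ▸ Pr.superfluous₁) (Pr'.ker_toKer ▸ Pr'.superfluous₁)
  exact ⟨⟨g₁⟩, ⟨g⟩⟩

end MinimalProjectivePresentation

/-- Nakayama's lemma for a nilpotent left ideal. -/
theorem Submodule.eq_top_of_sup_smul_eq_top {P : Type p} [AddCommGroup P] [Module A P]
    {L : Ideal A} {n : ℕ} (hL : L ^ n = ⊥) (W : Submodule A P)
    (hW : W ⊔ L • (⊤ : Submodule A P) = ⊤) : W = ⊤ := by
  have key : ∀ j : ℕ, W ⊔ L ^ j • (⊤ : Submodule A P) = ⊤ := by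
    intro j
    induction j with
    | zero => rw [Submodule.pow_zero, Ideal.one_eq_top, Submodule.top_smul, sup_top_eq]
    | succ j ih =>
      refine eq_top_iff.2 (ih.symm.le.trans (sup_le le_sup_left ?_))
      conv_lhs => rw [← hW]
      rw [Submodule.smul_sup, Submodule.pow_succ, Submodule.mul_smul]
      exact sup_le (le_sup_of_le_left (Submodule.smul_le.2 fun r _ n hn => W.smul_mem r hn))
        le_sup_right
  have := key n
  rwa [hL, Submodule.bot_smul, sup_bot_eq] at this

/-- A submodule of `L P + R P` is superfluous if `L` and `R` are nilpotent left ideals. -/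
theorem Submodule.isSuperfluous_of_le_sup_smul {P : Type p} [AddCommGroup P] [Module A P]
    {L R : Ideal A} {n : ℕ} (hL : L ^ n = ⊥) (hR : R ^ n = ⊥) (N : Submodule A P)
    (hN : N ≤ L • (⊤ : Submodule A P) ⊔ R • (⊤ : Submodule A P)) : N.IsSuperfluous := by
  intro K hK
  refine Submodule.eq_top_of_sup_smul_eq_top hR K
    (Submodule.eq_top_of_sup_smul_eq_top hL _ (eq_top_iff.2 (hK.symm.le.trans ?_)))
  exact sup_le (hN.trans (sup_le le_sup_right (le_sup_of_le_left le_sup_right)))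
    (le_sup_of_le_left le_sup_left)

end ProjectiveCover

/-! ### Maps into the Auslander-Reiten translate -/

section TauHom

universe a m q

/-- The coordinates of a finitely generated projective module. -/
theorem Module.Projective.exists_finite_coordinates (A : Type a) [Ring A] (P : Type p)
    [AddCommGroup P] [Module A P] [Module.Finite A P] [Module.Projective A P] :
    ∃ (n : ℕ) (c : Fin n → P →ₗ[A] A) (b : Fin n → P), ∀ x, x = ∑ i, c i x • b i := by
  obtain ⟨n, f, g, -, -, hfg⟩ := Module.Finite.exists_comp_eq_id_of_projective A P
  refine ⟨n, fun i => LinearMap.proj i ∘ₗ g, fun i => f (Pi.single i 1), fun x => ?_⟩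
  conv_lhs => rw [← LinearMap.id_apply (R := A) x, ← hfg, LinearMap.comp_apply,
    LinearMap.pi_apply_eq_sum_univ f (g x)]
  refine Finset.sum_congr rfl fun i _ => ?_
  congr 2
  ext j
  simp [Pi.single_apply, eq_comm]

variable (k : Type u) [Field k] {A : Type a} [Ring A] [Algebra k A]
variable {M : Type m} [AddCommGroup M] [Module A M]
variable (Pr : MinimalProjectivePresentation.{a, m, p} A M)
variable (X : Type q) [AddCommGroup X] [Module A X] [Module k X] [IsScalarTower k A X]

/-- The map `Hom_A(P₀, X) → Hom_A(P₁, X)` given by `d₁`. -/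
def MinimalProjectivePresentation.homMap : (Pr.P₀ →ₗ[A] X) →ₗ[k] (Pr.P₁ →ₗ[A] X) :=
  LinearMap.lcomp k X Pr.d₁

/-- The class in `Tr M` of an element of `Hom_A(P₁, A)`. -/
def MinimalProjectivePresentation.toTranspose : (Pr.P₁ →ₗ[A] A) →ₗ[k] Transpose Pr :=
  (homDual Pr.d₁).range.mkQ.restrictScalars k

theorem MinimalProjectivePresentation.toTranspose_surjective :
    Function.Surjective (Pr.toTranspose k) := by
  intro y
  obtain ⟨f, hf⟩ := (homDual Pr.d₁).range.mkQ_surjective y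
  exact ⟨f, hf⟩

variable {X}

/-- The linear form on `Tr M` sending the class of `f` to `φ (y ↦ f(y) x)`. -/
noncomputable def tauForm (φ : (Pr.homMap k X).range.dualAnnihilator) (x : X) :
    AuslanderReitenTranslate k Pr :=
  (((homDual Pr.d₁).range.restrictScalars k).liftQ
    ((φ : Module.Dual k (Pr.P₁ →ₗ[A] X)) ∘ₗ
      ({ toFun := fun f => f.smulRight x
         map_add' := fun f g => by ext y; simp [add_smul]
         map_smul' := fun c f => by ext y; simp } : (Pr.P₁ →ₗ[A] A) →ₗ[k] (Pr.P₁ →ₗ[A] X)))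
    (by
      rintro _ ⟨f, rfl⟩
      exact (Submodule.mem_dualAnnihilator _).1 φ.2 _ ⟨f.smulRight x, rfl⟩)) ∘ₗ
  (Submodule.Quotient.restrictScalarsEquiv k (homDual Pr.d₁).range).symm.toLinearMap

theorem tauForm_apply (φ : (Pr.homMap k X).range.dualAnnihilator) (x : X) (f : Pr.P₁ →ₗ[A] A) :
    (tauForm k Pr φ x).toLinearMap (Pr.toTranspose k f) =
      (φ : Module.Dual k (Pr.P₁ →ₗ[A] X)) (f.smulRight x) := rfl

theorem AuslanderReitenTranslate.ext {φ ψ : AuslanderReitenTranslate k Pr}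
    (h : ∀ f, φ.toLinearMap (Pr.toTranspose k f) = ψ.toLinearMap (Pr.toTranspose k f)) :
    φ = ψ := by
  refine LinearMap.ext fun y => ?_
  obtain ⟨f, rfl⟩ := Pr.toTranspose_surjective k y
  exact h f

variable (X)

/-- The map from the forms on `Coker (Hom_A(P₀, X) → Hom_A(P₁, X))` to `Hom_A(X, τ M)`. -/
noncomputable def tauHom :
    (Pr.homMap k X).range.dualAnnihilator →ₗ[k] (X →ₗ[A] AuslanderReitenTranslate k Pr) where
  toFun φ :=
    { toFun := fun x => tauForm k Pr φ x
      map_add' := fun x y => by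
        refine AuslanderReitenTranslate.ext k Pr fun f => ?_
        rw [tauForm_apply]
        refine Eq.trans ?_ (map_add (φ : Module.Dual k (Pr.P₁ →ₗ[A] X)) _ _)
        congr 1
        ext z
        simp
      map_smul' := fun b x => by
        refine AuslanderReitenTranslate.ext k Pr fun f => ?_
        rw [tauForm_apply]
        refine Eq.trans ?_ (tauForm_apply k Pr φ x (MulOpposite.op b • f)).symm
        congr 1
        ext z
        simp [mul_smul] }
  map_add' φ ψ := LinearMap.ext fun x => AuslanderReitenTranslate.ext k Pr fun f => rfl
  map_smul' c φ := LinearMap.ext fun x => AuslanderReitenTranslate.ext k Pr fun f => rfl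

theorem tauHom_apply (φ : (Pr.homMap k X).range.dualAnnihilator) (x : X) (f : Pr.P₁ →ₗ[A] A) :
    (tauHom k Pr X φ x).toLinearMap (Pr.toTranspose k f) =
      (φ : Module.Dual k (Pr.P₁ →ₗ[A] X)) (f.smulRight x) := rfl

theorem tauHom_injective : Function.Injective (tauHom k Pr X) := by
  have := Pr.finite₁
  have := Pr.projective₁
  obtain ⟨n, c, b, hcb⟩ := Module.Projective.exists_finite_coordinates A Pr.P₁
  intro φ φ' hφ
  refine Subtype.ext (LinearMap.ext fun g => ?_)
  have hg : g = ∑ i, (c i).smulRight (g (b i)) := by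
    ext x
    conv_lhs => rw [hcb x]
    simp
  rw [hg, map_sum, map_sum]
  refine Finset.sum_congr rfl fun i _ => ?_
  rw [← tauHom_apply, hφ, tauHom_apply]

theorem tauHom_surjective : Function.Surjective (tauHom k Pr X) := by
  have := Pr.finite₁
  have := Pr.projective₁
  have := Pr.finite₀
  have := Pr.projective₀
  obtain ⟨n, c, b, hcb⟩ := Module.Projective.exists_finite_coordinates A Pr.P₁
  obtain ⟨n', c', b', hcb'⟩ := Module.Projective.exists_finite_coordinates A Pr.P₀
  intro ψ
  have hψ : ∀ (r : A) (x : X) (f : Pr.P₁ →ₗ[A] A), (ψ (r • x)).toLinearMap (Pr.toTranspose k f) =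
      (ψ x).toLinearMap (Pr.toTranspose k (MulOpposite.op r • f)) := by
    intro r x f
    rw [map_smul]
    rfl
  have hψk : ∀ (r : k) (x : X) (f : Pr.P₁ →ₗ[A] A), (ψ (r • x)).toLinearMap (Pr.toTranspose k f) =
      r • (ψ x).toLinearMap (Pr.toTranspose k f) := by
    intro r x f
    rw [← algebraMap_smul A r x, hψ, ← map_smul, ← map_smul]
    congr 2
    ext y
    simp [Algebra.smul_def, Algebra.commutes]
  have hψa : ∀ (x y : X) (f : Pr.P₁ →ₗ[A] A), (ψ (x + y)).toLinearMap (Pr.toTranspose k f) =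
      (ψ x).toLinearMap (Pr.toTranspose k f) + (ψ y).toLinearMap (Pr.toTranspose k f) := by
    intro x y f
    rw [map_add]
    rfl
  -- The form inverse to `ψ`, written in coordinates of `P₁`.
  let φ : Module.Dual k (Pr.P₁ →ₗ[A] X) :=
    { toFun := fun g => ∑ i, (ψ (g (b i))).toLinearMap (Pr.toTranspose k (c i))
      map_add' := fun g h => by
        rw [← Finset.sum_add_distrib]
        exact Finset.sum_congr rfl fun i _ => by rw [LinearMap.add_apply, hψa]
      map_smul' := fun r g => by
        rw [RingHom.id_apply, Finset.smul_sum]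
        exact Finset.sum_congr rfl fun i _ => by rw [LinearMap.smul_apply, hψk] }
  have hφs : ∀ (f : Pr.P₁ →ₗ[A] A) (x : X),
      φ (f.smulRight x) = (ψ x).toLinearMap (Pr.toTranspose k f) := by
    intro f x
    change ∑ i, (ψ (f (b i) • x)).toLinearMap (Pr.toTranspose k (c i)) = _
    simp_rw [hψ]
    rw [← map_sum, ← map_sum]
    congr 2
    ext y
    conv_rhs => rw [hcb y]
    simp
  have hφ : φ ∈ (Pr.homMap k X).range.dualAnnihilator := by
    rw [Submodule.mem_dualAnnihilator]
    rintro _ ⟨h, rfl⟩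
    have hh : Pr.homMap k X h = ∑ j, (c' j ∘ₗ Pr.d₁).smulRight (h (b' j)) := by
      ext y
      change h (Pr.d₁ y) = _
      conv_lhs => rw [hcb' (Pr.d₁ y)]
      simp
    rw [hh, map_sum]
    refine Finset.sum_eq_zero fun j _ => ?_
    rw [hφs]
    have h0 : Pr.toTranspose k (c' j ∘ₗ Pr.d₁) = 0 :=
      (Submodule.Quotient.mk_eq_zero _).2 ⟨c' j, rfl⟩
    rw [h0, map_zero]
  refine ⟨⟨φ, hφ⟩, LinearMap.ext fun x => AuslanderReitenTranslate.ext k Pr fun f => ?_⟩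
  rw [tauHom_apply]
  exact hφs f x

/-- `Hom_A(X, τ M)` is dual to `Coker (Hom_A(P₀, X) → Hom_A(P₁, X))`. -/
noncomputable def tauHomEquiv :
    (Pr.homMap k X).range.dualAnnihilator ≃ₗ[k] (X →ₗ[A] AuslanderReitenTranslate k Pr) :=
  LinearEquiv.ofBijective (tauHom k Pr X) ⟨tauHom_injective k Pr X, tauHom_surjective k Pr X⟩

/-- The kernel of `Hom_A(P₀, X) → Hom_A(P₁, X)` is `Hom_A(M, X)`. -/
noncomputable def MinimalProjectivePresentation.homMapKerEquiv :
    (M →ₗ[A] X) ≃ₗ[k] (Pr.homMap k X).ker :=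
  LinearEquiv.ofBijective
    ((LinearMap.lcomp k X Pr.d₀).codRestrict (Pr.homMap k X).ker fun f => by
      ext y
      change f (Pr.d₀ (Pr.d₁ y)) = 0
      rw [(Pr.exact _).2 ⟨y, rfl⟩, map_zero])
    ⟨fun f g hfg => by
      ext m
      obtain ⟨y, rfl⟩ := Pr.surjective m
      exact LinearMap.congr_fun (congrArg Subtype.val hfg) y,
    fun ⟨h, hh⟩ => by
      have hle : Pr.d₀.ker ≤ h.ker := by
        intro y hy
        obtain ⟨z, rfl⟩ := (Pr.exact y).1 hy
        exact LinearMap.congr_fun hh z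
      let e := Pr.d₀.quotKerEquivOfSurjective Pr.surjective
      refine ⟨Pr.d₀.ker.liftQ h hle ∘ₗ e.symm.toLinearMap, Subtype.ext (LinearMap.ext fun y => ?_)⟩
      change Pr.d₀.ker.liftQ h hle (e.symm (Pr.d₀ y)) = h y
      have : e.symm (Pr.d₀ y) = Pr.d₀.ker.mkQ y := by
        rw [LinearEquiv.symm_apply_eq]
        rfl
      rw [this, Submodule.mkQ_apply, Submodule.liftQ_apply]⟩

/-- The dimension of `Hom_A(X, τ M)`: the alternating sum along
`0 → Hom_A(M, X) → Hom_A(P₀, X) → Hom_A(P₁, X) → D Hom_A(X, τ M) → 0`. -/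
theorem finrank_tauHom [Module.Finite k (Pr.P₀ →ₗ[A] X)] [Module.Finite k (Pr.P₁ →ₗ[A] X)] :
    Module.Finite k (X →ₗ[A] AuslanderReitenTranslate k Pr) ∧
    (Module.finrank k (X →ₗ[A] AuslanderReitenTranslate k Pr) : ℤ) =
      (Module.finrank k (M →ₗ[A] X) : ℤ) - Module.finrank k (Pr.P₀ →ₗ[A] X)
        + Module.finrank k (Pr.P₁ →ₗ[A] X) := by
  refine ⟨Module.Finite.equiv (tauHomEquiv k Pr X), ?_⟩
  rw [← (tauHomEquiv k Pr X).finrank_eq, (Pr.homMapKerEquiv k X).finrank_eq]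
  have h₁ := LinearMap.finrank_range_add_finrank_ker (Pr.homMap k X)
  have h₂ := Subspace.finrank_add_finrank_dualAnnihilator_eq (Pr.homMap k X).range
  omega

end TauHom

/-! ### Projective modules given by idempotents -/

section IdempotentModule

universe a i q

variable {A : Type a} [Ring A] {ι : Type i}

/-- The left module `∏ i, A e_i`, as a submodule of `ι → A`, for a family of idempotents `e`:
an element `x` of `A` lies in `A e_i` exactly if `x e_i = x`. -/
def idempotentSubmodule (e : ι → A) : Submodule A (ι → A) where
  carrier := {f | ∀ i, f i * e i = f i}
  add_mem' {f g} hf hg i := by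
    change (f i + g i) * e i = f i + g i
    rw [add_mul, hf i, hg i]
  zero_mem' i := zero_mul _
  smul_mem' c f hf i := by
    change c * f i * e i = c * f i
    rw [mul_assoc, hf i]

/-- The left module `∏ i, A e_i`. -/
def IdempotentModule (e : ι → A) : Type (max i a) := idempotentSubmodule e

namespace IdempotentModule

noncomputable instance (e : ι → A) : AddCommGroup (IdempotentModule e) :=
  inferInstanceAs (AddCommGroup (idempotentSubmodule e))

noncomputable instance (e : ι → A) : Module A (IdempotentModule e) :=
  inferInstanceAs (Module A (idempotentSubmodule e))

variable {e : ι → A}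

/-- The component of an element of `∏ i, A e_i` at `i`. -/
noncomputable def coord (i : ι) : IdempotentModule e →ₗ[A] A :=
  LinearMap.proj i ∘ₗ (idempotentSubmodule e).subtype

@[ext]
theorem ext {f g : IdempotentModule e} (h : ∀ i, coord i f = coord i g) : f = g :=
  Subtype.ext (funext h)

theorem coord_mul (f : IdempotentModule e) (i : ι) : coord i f * e i = coord i f := f.2 i

/-- The projection `f ↦ (f_i e_i)` of `ι → A` onto `∏ i, A e_i`. -/
noncomputable def projection (he : ∀ i, e i * e i = e i) : (ι → A) →ₗ[A] IdempotentModule e :=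
  LinearMap.codRestrict (idempotentSubmodule e)
    (LinearMap.pi fun i => LinearMap.toSpanSingleton A A (e i) ∘ₗ LinearMap.proj i)
    fun f i => by
      change f i * e i * e i = f i * e i
      rw [mul_assoc, he]

theorem coord_projection (he : ∀ i, e i * e i = e i) (f : ι → A) (i : ι) :
    coord i (projection he f) = f i * e i := rfl

theorem projection_comp_coord (he : ∀ i, e i * e i = e i) :
    projection he ∘ₗ LinearMap.pi coord = LinearMap.id :=
  LinearMap.ext fun f => ext fun i => coord_mul f i

open Classical in
/-- The element of `∏ i, A e_i` with the component `x e_i` at `i` and zero elsewhere. -/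
noncomputable def single (he : ∀ i, e i * e i = e i) (i : ι) : A →ₗ[A] IdempotentModule e :=
  projection he ∘ₗ LinearMap.single A (fun _ => A) i

theorem coord_single_same (he : ∀ i, e i * e i = e i) (i : ι) (x : A) :
    coord i (single he i x) = x * e i := by
  classical
  rw [single, LinearMap.comp_apply, coord_projection, LinearMap.single_apply, Pi.single_eq_same]

theorem coord_single_of_ne (he : ∀ i, e i * e i = e i) {i j : ι} (h : j ≠ i) (x : A) :
    coord j (single he i x) = 0 := by
  classical
  rw [single, LinearMap.comp_apply, coord_projection, LinearMap.single_apply,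
    Pi.single_eq_of_ne h, zero_mul]

theorem single_mul (he : ∀ i, e i * e i = e i) (i : ι) (x : A) :
    single he i (x * e i) = single he i x := by
  ext j
  by_cases h : j = i
  · subst h
    rw [coord_single_same, coord_single_same, mul_assoc, he]
  · rw [coord_single_of_ne he h, coord_single_of_ne he h]

variable [Fintype ι]

theorem eq_sum_single (he : ∀ i, e i * e i = e i) (f : IdempotentModule e) :
    f = ∑ i, single he i (coord i f) := by
  ext j
  rw [map_sum, Finset.sum_eq_single j]
  · rw [coord_single_same, coord_mul]
  · intro i _ h
    exact coord_single_of_ne he h.symm _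
  · simp

theorem eq_sum_smul_single (he : ∀ i, e i * e i = e i) (f : IdempotentModule e) :
    f = ∑ i, coord i f • single he i 1 := by
  conv_lhs => rw [eq_sum_single he f]
  refine Finset.sum_congr rfl fun i _ => ?_
  rw [← map_smul, smul_eq_mul, mul_one]

theorem projective (he : ∀ i, e i * e i = e i) : Module.Projective A (IdempotentModule e) :=
  Module.Projective.of_split _ _ (projection_comp_coord he)

theorem finite (he : ∀ i, e i * e i = e i) : Module.Finite A (IdempotentModule e) :=
  Module.Finite.of_surjective (projection he) fun f =>
    ⟨LinearMap.pi coord f, LinearMap.congr_fun (projection_comp_coord he) f⟩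

variable {X : Type q} [AddCommGroup X] [Module A X]

variable (e) in
/-- The homomorphism `f ↦ ∑ i, f_i x_i` given by elements `x_i`. -/
noncomputable def lift (x : ι → X) : IdempotentModule e →ₗ[A] X :=
  ∑ i, LinearMap.toSpanSingleton A X (x i) ∘ₗ coord i

theorem lift_apply (x : ι → X) (f : IdempotentModule e) : lift e x f = ∑ i, coord i f • x i := by
  rw [lift, LinearMap.sum_apply]
  rfl

theorem lift_single (he : ∀ i, e i * e i = e i) (x : ι → X) (i : ι) (r : A) :
    lift e x (single he i r) = (r * e i) • x i := by
  classical
  rw [lift_apply, Finset.sum_eq_single i]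
  · rw [coord_single_same]
  · intro j _ h
    rw [coord_single_of_ne he h, zero_smul]
  · simp

variable (k : Type u) [Field k] [Algebra k A] [Module k X] [IsScalarTower k A X]

variable (X) in
/-- `Hom_A(∏ i, A e_i, X)` is `∏ i, e_i X`. -/
noncomputable def homEquiv (he : ∀ i, e i * e i = e i) :
    (IdempotentModule e →ₗ[A] X) ≃ₗ[k] (∀ i, (Algebra.lsmul k k X (e i)).range) where
  toFun g i := ⟨g (single he i 1), g (single he i 1), by
    change e i • g (single he i 1) = _
    rw [← map_smul, ← map_smul, smul_eq_mul, ← one_mul (e i * 1), mul_one, single_mul]⟩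
  map_add' g h := rfl
  map_smul' c g := rfl
  invFun x := lift e fun i => (x i : X)
  left_inv g := by
    ext f
    conv_rhs => rw [eq_sum_smul_single he f]
    rw [lift_apply, map_sum]
    exact Finset.sum_congr rfl fun i _ => (map_smul _ _ _).symm
  right_inv x := by
    funext i
    refine Subtype.ext ?_
    obtain ⟨y, hy⟩ := (x i).2
    change lift e (fun i => (x i : X)) (single he i 1) = _
    rw [lift_single, one_mul, ← hy]
    change e i • e i • y = e i • y
    rw [smul_smul, he]

variable (X) in
theorem finite_hom [Module.Finite k X] (he : ∀ i, e i * e i = e i) :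
    Module.Finite k (IdempotentModule e →ₗ[A] X) :=
  Module.Finite.equiv (homEquiv X k he).symm

variable (X) in
theorem finrank_hom [Module.Finite k X] (he : ∀ i, e i * e i = e i) :
    Module.finrank k (IdempotentModule e →ₗ[A] X) =
      ∑ i, Module.finrank k (Algebra.lsmul k k X (e i)).range := by
  rw [(homEquiv X k he).finrank_eq, Module.finrank_pi_fintype]

end IdempotentModule

end IdempotentModule

/-! ### The enveloping algebra -/

section Enveloping

universe l

variable {k : Type u} [Field k] {Λ : Type l} [Ring Λ] [Algebra k Λ]

open MulOpposite (op unop)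

namespace EnvelopingAlgebra

instance isScalarTower_self : IsScalarTower k (EnvelopingAlgebra k Λ) Λ where
  smul_assoc c a x := by
    induction a using TensorProduct.induction_on with
    | zero =>
      have h : (0 : EnvelopingAlgebra k Λ) • x = 0 := Module.zero_smul x
      rw [smul_zero]
      exact h.trans ((congrArg (c • ·) h).trans (smul_zero c)).symm
    | add a b ha hb => rw [smul_add, add_smul, ha, hb, add_smul, smul_add]
    | tmul u v =>
      rw [TensorProduct.smul_tmul', ← MulOpposite.op_unop v, tmul_smul, tmul_smul,
        smul_mul_assoc, smul_mul_assoc]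

/-- Bimodule endomorphisms of `Λ` are multiplications by central elements. -/
noncomputable def endEquivCenter :
    (Λ →ₗ[EnvelopingAlgebra k Λ] Λ) ≃ₗ[k] Subalgebra.center k Λ where
  toFun f := ⟨f 1, by
    rw [Subalgebra.mem_center_iff]
    intro b
    have h₁ := map_smul f (b ⊗ₜ[k] op (1 : Λ) : EnvelopingAlgebra k Λ) 1
    have h₂ := map_smul f ((1 : Λ) ⊗ₜ[k] op b : EnvelopingAlgebra k Λ) 1
    rw [tmul_smul, tmul_smul, mul_one, mul_one] at h₁
    rw [tmul_smul, tmul_smul, one_mul, one_mul, one_mul] at h₂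
    rw [← mul_one (b * f 1), ← h₁, h₂]⟩
  map_add' f g := rfl
  map_smul' c f := rfl
  invFun z :=
    { toFun := fun x => x * z
      map_add' := fun x y => add_mul _ _ _
      map_smul' := fun a x => by
        have hz := Subalgebra.mem_center_iff.1 z.2
        induction a using TensorProduct.induction_on with
        | zero =>
          have h (y : Λ) : (0 : EnvelopingAlgebra k Λ) • y = 0 := Module.zero_smul y
          exact (congrArg (· * (z : Λ)) (h x)).trans ((zero_mul _).trans (h _).symm)
        | add a b ha hb => rw [add_smul, add_mul, ha, hb, RingHom.id_apply, RingHom.id_apply,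
            RingHom.id_apply, add_smul]
        | tmul u v =>
          rw [RingHom.id_apply, ← MulOpposite.op_unop v, tmul_smul, tmul_smul]
          rw [mul_assoc, mul_assoc, mul_assoc, mul_assoc, hz (unop v)] }
  left_inv f := by
    ext x
    have h := map_smul f (x ⊗ₜ[k] op (1 : Λ) : EnvelopingAlgebra k Λ) 1
    rw [tmul_smul, tmul_smul, mul_one, mul_one, mul_one] at h
    exact h.symm
  right_inv z := Subtype.ext (one_mul _)

/-- The idempotent `e ⊗ f` acts on `Λ` as the projection onto `e Λ f`. -/
theorem range_lsmul_tmul (e f : Λ) :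
    (Algebra.lsmul k k Λ (e ⊗ₜ[k] op f : EnvelopingAlgebra k Λ)).range =
      cornerSubspace k e f := by
  rw [cornerSubspace]
  congr 1
  ext x
  rw [LinearMap.mulLeftRight_apply]
  exact tmul_smul k Λ e f x

/-- The left ideal of the enveloping algebra generated by the `r ⊗ 1` with `r` in `I`. -/
def leftIdeal (k : Type u) [Field k] {Λ : Type l} [Ring Λ] [Algebra k Λ] (I : Ideal Λ) :
    Ideal (EnvelopingAlgebra k Λ) :=
  Ideal.span ((fun r : Λ => (r ⊗ₜ[k] op (1 : Λ) : EnvelopingAlgebra k Λ)) '' I)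

/-- The left ideal of the enveloping algebra generated by the `1 ⊗ r` with `r` in `I`. -/
def rightIdeal (k : Type u) [Field k] {Λ : Type l} [Ring Λ] [Algebra k Λ] (I : Ideal Λ) :
    Ideal (EnvelopingAlgebra k Λ) :=
  Ideal.span ((fun r : Λ => ((1 : Λ) ⊗ₜ[k] op r : EnvelopingAlgebra k Λ)) '' I)

theorem tmul_op_mul_tmul_op (a b c d : Λ) :
    (a ⊗ₜ[k] op b * c ⊗ₜ[k] op d : EnvelopingAlgebra k Λ) = (a * c) ⊗ₜ[k] op (d * b) := by
  rw [Algebra.TensorProduct.tmul_mul_tmul, MulOpposite.op_mul]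

theorem tmul_mem_leftIdeal {I : Ideal Λ} {r : Λ} (hr : r ∈ I) (v : Λ) :
    (r ⊗ₜ[k] op v : EnvelopingAlgebra k Λ) ∈ leftIdeal k I := by
  have := (leftIdeal k I).mul_mem_left ((1 : Λ) ⊗ₜ[k] op v) (Ideal.subset_span ⟨r, hr, rfl⟩)
  rwa [tmul_op_mul_tmul_op, one_mul, one_mul] at this

theorem tmul_mem_rightIdeal {I : Ideal Λ} {r : Λ} (hr : r ∈ I) (u : Λ) :
    (u ⊗ₜ[k] op r : EnvelopingAlgebra k Λ) ∈ rightIdeal k I := by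
  have := (rightIdeal k I).mul_mem_left (u ⊗ₜ[k] op (1 : Λ)) (Ideal.subset_span ⟨r, hr, rfl⟩)
  rwa [tmul_op_mul_tmul_op, mul_one, mul_one] at this

theorem leftIdeal_mul_le (I J : Ideal Λ) [J.IsTwoSided] :
    leftIdeal k J * leftIdeal k I ≤ leftIdeal k (J * I) := by
  have key : ∀ s ∈ leftIdeal k I, ∀ r ∈ J,
      (r ⊗ₜ[k] op (1 : Λ) * s : EnvelopingAlgebra k Λ) ∈ leftIdeal k (J * I) := by
    intro s hs
    induction hs using Submodule.span_induction with
    | mem s hs =>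
      obtain ⟨t, ht, rfl⟩ := hs
      intro r hr
      rw [tmul_op_mul_tmul_op]
      exact tmul_mem_leftIdeal (Ideal.mul_mem_mul hr ht) _
    | zero => intro r _; rw [mul_zero]; exact Submodule.zero_mem _
    | add s t _ _ hs ht => intro r hr; rw [mul_add]; exact Submodule.add_mem _ (hs r hr) (ht r hr)
    | smul a s _ hs =>
      intro r hr
      rw [smul_eq_mul]
      induction a using TensorProduct.induction_on with
      | zero => rw [zero_mul, mul_zero]; exact Submodule.zero_mem _
      | add a b ha hb => rw [add_mul, mul_add]; exact Submodule.add_mem _ ha hb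
      | tmul u v =>
        rw [← mul_assoc, ← MulOpposite.op_unop v, tmul_op_mul_tmul_op, mul_one,
          show ((r * u) ⊗ₜ[k] op (unop v) : EnvelopingAlgebra k Λ) =
            (1 : Λ) ⊗ₜ[k] op (unop v) * (r * u) ⊗ₜ[k] op (1 : Λ) by
            rw [tmul_op_mul_tmul_op, one_mul, one_mul], mul_assoc]
        exact Ideal.mul_mem_left _ _ (hs _ (J.mul_mem_right u hr))
  rw [Ideal.mul_le]
  intro r hr s hs
  induction hr using Submodule.span_induction with
  | mem r hr => obtain ⟨t, ht, rfl⟩ := hr; exact key s hs t ht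
  | zero => rw [zero_mul]; exact Submodule.zero_mem _
  | add r t _ _ hr ht => rw [add_mul]; exact Submodule.add_mem _ hr ht
  | smul a r _ hr => rw [smul_eq_mul, mul_assoc]; exact Ideal.mul_mem_left _ _ hr

theorem rightIdeal_mul_le (I J : Ideal Λ) [I.IsTwoSided] :
    rightIdeal k J * rightIdeal k I ≤ rightIdeal k (I * J) := by
  have key : ∀ s ∈ rightIdeal k I, ∀ r ∈ J,
      ((1 : Λ) ⊗ₜ[k] op r * s : EnvelopingAlgebra k Λ) ∈ rightIdeal k (I * J) := by
    intro s hs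
    induction hs using Submodule.span_induction with
    | mem s hs =>
      obtain ⟨t, ht, rfl⟩ := hs
      intro r hr
      rw [tmul_op_mul_tmul_op]
      exact tmul_mem_rightIdeal (Ideal.mul_mem_mul ht hr) _
    | zero => intro r _; rw [mul_zero]; exact Submodule.zero_mem _
    | add s t _ _ hs ht => intro r hr; rw [mul_add]; exact Submodule.add_mem _ (hs r hr) (ht r hr)
    | smul a s _ hs =>
      intro r hr
      rw [smul_eq_mul]
      induction a using TensorProduct.induction_on with
      | zero => rw [zero_mul, mul_zero]; exact Submodule.zero_mem _
      | add a b ha hb => rw [add_mul, mul_add]; exact Submodule.add_mem _ ha hb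
      | tmul u v =>
        rw [← mul_assoc, ← MulOpposite.op_unop v, tmul_op_mul_tmul_op, one_mul,
          show (u ⊗ₜ[k] op (unop v * r) : EnvelopingAlgebra k Λ) =
            u ⊗ₜ[k] op (1 : Λ) * (1 : Λ) ⊗ₜ[k] op (unop v * r) by
            rw [tmul_op_mul_tmul_op, mul_one, mul_one], mul_assoc]
        exact Ideal.mul_mem_left _ _ (hs _ (J.mul_mem_left _ hr))
  rw [Ideal.mul_le]
  intro r hr s hs
  induction hr using Submodule.span_induction with
  | mem r hr => obtain ⟨t, ht, rfl⟩ := hr; exact key s hs t ht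
  | zero => rw [zero_mul]; exact Submodule.zero_mem _
  | add r t _ _ hr ht => rw [add_mul]; exact Submodule.add_mem _ hr ht
  | smul a r _ hr => rw [smul_eq_mul, mul_assoc]; exact Ideal.mul_mem_left _ _ hr

theorem leftIdeal_pow_le (I : Ideal Λ) [I.IsTwoSided] (n : ℕ) :
    leftIdeal k I ^ n ≤ leftIdeal k (I ^ n) := by
  induction n with
  | zero =>
    rw [Submodule.pow_zero, Submodule.pow_zero, Ideal.one_eq_top, Ideal.one_eq_top]
    refine le_of_eq (((Ideal.eq_top_iff_one _).2 ?_).symm)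
    exact tmul_mem_leftIdeal Submodule.mem_top 1
  | succ n ih =>
    rw [Submodule.pow_succ, Submodule.pow_succ]
    exact (Ideal.mul_mono ih le_rfl).trans (leftIdeal_mul_le I (I ^ n))

theorem rightIdeal_pow_le (I : Ideal Λ) [I.IsTwoSided] (n : ℕ) :
    rightIdeal k I ^ n ≤ rightIdeal k (I ^ n) := by
  induction n with
  | zero =>
    rw [Submodule.pow_zero, Submodule.pow_zero, Ideal.one_eq_top, Ideal.one_eq_top]
    refine le_of_eq (((Ideal.eq_top_iff_one _).2 ?_).symm)
    exact tmul_mem_rightIdeal Submodule.mem_top 1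
  | succ n ih =>
    rw [Submodule.pow_succ, Ideal.IsTwoSided.pow_succ]
    exact (Ideal.mul_mono ih le_rfl).trans (rightIdeal_mul_le I (I ^ n))

theorem leftIdeal_pow_eq_bot {I : Ideal Λ} [I.IsTwoSided] {n : ℕ} (h : I ^ n = ⊥) :
    leftIdeal k I ^ n = ⊥ := by
  refine eq_bot_iff.2 ((leftIdeal_pow_le I n).trans ?_)
  rw [h, leftIdeal, Ideal.span_le]
  rintro _ ⟨r, hr, rfl⟩
  rw [show r = 0 from hr]
  exact TensorProduct.zero_tmul _ _

theorem rightIdeal_pow_eq_bot {I : Ideal Λ} [I.IsTwoSided] {n : ℕ} (h : I ^ n = ⊥) :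
    rightIdeal k I ^ n = ⊥ := by
  refine eq_bot_iff.2 ((rightIdeal_pow_le I n).trans ?_)
  rw [h, rightIdeal, Ideal.span_le]
  rintro _ ⟨r, hr, rfl⟩
  rw [show r = 0 from hr]
  exact TensorProduct.tmul_zero _ _

/-- The linear form `u ⊗ v ↦ φ(u) ψ(v)` on the enveloping algebra. -/
noncomputable def pairing (φ ψ : Λ →ₗ[k] k) : EnvelopingAlgebra k Λ →ₗ[k] k :=
  LinearMap.mul' k k ∘ₗ
    TensorProduct.map φ (ψ ∘ₗ (MulOpposite.opLinearEquiv k).symm.toLinearMap)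

theorem pairing_tmul (φ ψ : Λ →ₗ[k] k) (u v : Λ) :
    pairing φ ψ (u ⊗ₜ[k] op v : EnvelopingAlgebra k Λ) = φ u * ψ v := rfl

end EnvelopingAlgebra

end Enveloping

/-! ### The minimal bimodule presentation of a bound quiver algebra -/

section StandardPresentation

universe l q

open MulOpposite (op unop)
open EnvelopingAlgebra

/-- The features of a bound quiver algebra `Λ` with vertices `V` and arrows `E` on which its
minimal bimodule presentation depends: the vertices form a complete family of orthogonal
idempotents, the arrows generate `Λ` over the vertices, lie in a nilpotent ideal, and are linearly
independent modulo its square. The last condition is expressed by linear forms `arrowCoeff a` which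
pick the coefficient of the arrow `a`; in the same way, the characters `vertexCoeff x` express that
the vertices are linearly independent modulo the ideal generated by the arrows. -/
structure BoundQuiverStructure (k : Type u) [Field k] (Λ : Type l) [Ring Λ] [Algebra k Λ]
    (V : Type v) (E : Type w) [Fintype V] where
  src : E → V
  tgt : E → V
  vertex : V → Λ
  arrow : E → Λ
  vertex_mul_self : ∀ x, vertex x * vertex x = vertex x
  vertex_mul_of_ne : ∀ x y, x ≠ y → vertex x * vertex y = 0
  sum_vertex : ∑ x, vertex x = 1
  vertex_mul_arrow : ∀ a, vertex (tgt a) * arrow a = arrow a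
  arrow_mul_vertex : ∀ a, arrow a * vertex (src a) = arrow a
  span_eq_top : ∀ W : Submodule k Λ, (∀ x, vertex x ∈ W) →
    (∀ a, ∀ w ∈ W, arrow a * w ∈ W) → W = ⊤
  rad : Ideal Λ
  isTwoSided_rad : rad.IsTwoSided
  arrow_mem_rad : ∀ a, arrow a ∈ rad
  rad_nilpotent : ∃ n : ℕ, rad ^ n = ⊥
  vertexCoeff : V → Λ →ₐ[k] k
  vertexCoeff_vertex_self : ∀ x, vertexCoeff x (vertex x) = 1
  vertexCoeff_vertex_of_ne : ∀ x y, x ≠ y → vertexCoeff x (vertex y) = 0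
  vertexCoeff_arrow : ∀ x a, vertexCoeff x (arrow a) = 0
  arrowCoeff : E → Λ →ₗ[k] k
  arrowCoeff_mul_arrow_self : ∀ a u, arrowCoeff a (u * arrow a) = vertexCoeff (tgt a) u
  arrowCoeff_mul_arrow_of_ne : ∀ a b u, a ≠ b → arrowCoeff a (u * arrow b) = 0

namespace BoundQuiverStructure

variable {k : Type u} [Field k] {Λ : Type l} [Ring Λ] [Algebra k Λ]
variable {V : Type v} {E : Type w} [Fintype V]
variable (S : BoundQuiverStructure k Λ V E)

theorem vertex_mul_arrow_of_ne {x : V} {a : E} (h : x ≠ S.tgt a) : S.vertex x * S.arrow a = 0 := by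
  rw [← S.vertex_mul_arrow a, ← mul_assoc, S.vertex_mul_of_ne _ _ h, zero_mul]

theorem mul_vertex_sub_mem_rad (u : Λ) (x : V) :
    u * S.vertex x - S.vertexCoeff x u • S.vertex x ∈ S.rad := by
  let W : Submodule k Λ := (S.rad.restrictScalars k).comap
    (LinearMap.mulRight k (S.vertex x) - (S.vertexCoeff x).toLinearMap.smulRight (S.vertex x))
  have hW : W = ⊤ := by
    refine S.span_eq_top W (fun y => ?_) fun a w hw => ?_
    · change S.vertex y * S.vertex x - S.vertexCoeff x (S.vertex y) • S.vertex x ∈ S.rad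
      by_cases h : y = x
      · rw [h, S.vertex_mul_self, S.vertexCoeff_vertex_self, one_smul, sub_self]
        exact S.rad.zero_mem
      · rw [S.vertex_mul_of_ne _ _ h, S.vertexCoeff_vertex_of_ne _ _ (Ne.symm h), zero_smul,
          sub_self]
        exact S.rad.zero_mem
    · change S.arrow a * w * S.vertex x - S.vertexCoeff x (S.arrow a * w) • S.vertex x ∈ S.rad
      rw [map_mul, S.vertexCoeff_arrow, zero_mul, zero_smul, sub_zero, mul_assoc]
      have := S.isTwoSided_rad
      exact S.rad.mul_mem_right _ (S.arrow_mem_rad a)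
  exact hW.ge (Submodule.mem_top : u ∈ ⊤)

theorem vertex_mul_sub_mem_rad (v : Λ) (x : V) :
    S.vertex x * v - S.vertexCoeff x v • S.vertex x ∈ S.rad := by
  let W : Submodule k Λ := (S.rad.restrictScalars k).comap
    (LinearMap.mulLeft k (S.vertex x) - (S.vertexCoeff x).toLinearMap.smulRight (S.vertex x))
  have hW : W = ⊤ := by
    refine S.span_eq_top W (fun y => ?_) fun a w hw => ?_
    · change S.vertex x * S.vertex y - S.vertexCoeff x (S.vertex y) • S.vertex x ∈ S.rad
      by_cases h : x = y
      · rw [h, S.vertex_mul_self, S.vertexCoeff_vertex_self, one_smul, sub_self]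
        exact S.rad.zero_mem
      · rw [S.vertex_mul_of_ne _ _ h, S.vertexCoeff_vertex_of_ne _ _ h, zero_smul, sub_self]
        exact S.rad.zero_mem
    · change S.vertex x * (S.arrow a * w) - S.vertexCoeff x (S.arrow a * w) • S.vertex x ∈ S.rad
      rw [map_mul, S.vertexCoeff_arrow, zero_mul, zero_smul, sub_zero]
      have := S.isTwoSided_rad
      exact S.rad.mul_mem_left _ (S.rad.mul_mem_right _ (S.arrow_mem_rad a))
  exact hW.ge (Submodule.mem_top : v ∈ ⊤)

/-- The idempotent `y ⊗ x` of the enveloping algebra, for vertices `x` and `y`. -/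
def bivertex (y x : V) : EnvelopingAlgebra k Λ := S.vertex y ⊗ₜ[k] op (S.vertex x)

theorem bivertex_mul_self (y x : V) : S.bivertex y x * S.bivertex y x = S.bivertex y x := by
  rw [bivertex, tmul_op_mul_tmul_op, S.vertex_mul_self, S.vertex_mul_self]

/-- The coefficient of `y ⊗ x` in an element of the enveloping algebra. -/
noncomputable def bivertexCoeff (y x : V) : EnvelopingAlgebra k Λ →ₗ[k] k :=
  pairing (S.vertexCoeff y).toLinearMap (S.vertexCoeff x).toLinearMap

theorem bivertexCoeff_tmul (y x : V) (u v : Λ) :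
    S.bivertexCoeff y x (u ⊗ₜ[k] op v : EnvelopingAlgebra k Λ) =
      S.vertexCoeff y u * S.vertexCoeff x v := rfl

/-- Modulo the radical, `(Λ ⊗ Λᵒᵖ) (y ⊗ x)` is spanned over `k` by `y ⊗ x`. -/
theorem mul_bivertex_sub_mem (y x : V) (r : EnvelopingAlgebra k Λ) :
    r * S.bivertex y x - S.bivertexCoeff y x r • S.bivertex y x ∈
      leftIdeal k S.rad ⊔ rightIdeal k S.rad := by
  induction r using TensorProduct.induction_on with
  | zero =>
    rw [zero_mul, map_zero, zero_smul, sub_self]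
    exact Submodule.zero_mem _
  | add r s hr hs =>
    rw [add_mul, map_add, add_smul, add_sub_add_comm]
    exact Submodule.add_mem _ hr hs
  | tmul u v =>
    have h₁ := tmul_mem_leftIdeal (k := k) (S.mul_vertex_sub_mem_rad u y)
      (S.vertex x * unop v)
    have h₂ := tmul_mem_rightIdeal (k := k) (S.vertex_mul_sub_mem_rad (unop v) x)
      (S.vertexCoeff y u • S.vertex y)
    convert Submodule.add_mem_sup h₁ h₂ using 1
    rw [← MulOpposite.op_unop v, bivertexCoeff_tmul, bivertex, tmul_op_mul_tmul_op,
      MulOpposite.unop_op, MulOpposite.op_sub, TensorProduct.sub_tmul, TensorProduct.tmul_sub,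
      sub_add_sub_cancel, MulOpposite.op_smul, TensorProduct.tmul_smul, TensorProduct.smul_tmul',
      TensorProduct.smul_tmul', smul_smul, mul_comm]

/-- If the elements of the kernel of a homomorphism on `∏ i, Λ y_i ⊗ x_i Λ` have all their
coefficients at `y_i ⊗ x_i` equal to zero, then the kernel lies in the radical and is
superfluous. -/
theorem isSuperfluous_ker {ι : Type q} [Fintype ι] (y x : ι → V) {N : Type p} [AddCommGroup N]
    [Module (EnvelopingAlgebra k Λ) N]
    (d : IdempotentModule (fun i => S.bivertex (y i) (x i)) →ₗ[EnvelopingAlgebra k Λ] N)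
    (hd : ∀ f, d f = 0 → ∀ i, S.bivertexCoeff (y i) (x i) (IdempotentModule.coord i f) = 0) :
    Submodule.IsSuperfluous (A := EnvelopingAlgebra k Λ) d.ker := by
  have := S.isTwoSided_rad
  obtain ⟨n, hn⟩ := S.rad_nilpotent
  refine Submodule.isSuperfluous_of_le_sup_smul (leftIdeal_pow_eq_bot hn)
    (rightIdeal_pow_eq_bot hn) _ fun f hf => ?_
  have he : ∀ i, S.bivertex (y i) (x i) * S.bivertex (y i) (x i) = S.bivertex (y i) (x i) :=
    fun i => S.bivertex_mul_self _ _
  rw [IdempotentModule.eq_sum_smul_single he f]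
  refine Submodule.sum_mem _ fun i _ => ?_
  have hi := S.mul_bivertex_sub_mem (y i) (x i) (IdempotentModule.coord i f)
  rw [hd f hf i, zero_smul, sub_zero, IdempotentModule.coord_mul] at hi
  obtain ⟨r, hr, s, hs, hrs⟩ := Submodule.mem_sup.1 hi
  rw [← hrs, add_smul]
  exact Submodule.add_mem_sup (Submodule.smul_mem_smul hr Submodule.mem_top)
    (Submodule.smul_mem_smul hs Submodule.mem_top)

/-- The bimodule `P₀ = ∏ x, Λ x ⊗ x Λ`. -/
abbrev P₀ : Type (max v l) :=
  IdempotentModule fun x => S.bivertex x x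

/-- The bimodule `P₁ = ∏ a, Λ t(a) ⊗ s(a) Λ`. -/
abbrev P₁ : Type (max w l) :=
  IdempotentModule fun a => S.bivertex (S.tgt a) (S.src a)

/-- The element of `P₀` with component `r (x ⊗ x)` at `x`. -/
noncomputable abbrev single₀ (x : V) : EnvelopingAlgebra k Λ →ₗ[EnvelopingAlgebra k Λ] S.P₀ :=
  IdempotentModule.single (fun x => S.bivertex_mul_self x x) x

/-- The element `a ⊗ s(a) - t(a) ⊗ a` of `P₀`. -/
noncomputable def relator (a : E) : S.P₀ :=
  S.single₀ (S.src a) (S.arrow a ⊗ₜ[k] op 1) - S.single₀ (S.tgt a) (1 ⊗ₜ[k] op (S.arrow a))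

/-- The multiplication `P₀ → Λ`, `u ⊗ v ↦ u v`. -/
noncomputable def d₀ : S.P₀ →ₗ[EnvelopingAlgebra k Λ] Λ :=
  IdempotentModule.lift (fun x => S.bivertex x x) fun _ => 1

theorem d₀_single (x : V) (u v : Λ) :
    S.d₀ (S.single₀ x (u ⊗ₜ[k] op v)) = u * S.vertex x * v := by
  rw [d₀, IdempotentModule.lift_single, bivertex, tmul_op_mul_tmul_op, tmul_smul, mul_one,
    mul_assoc, ← mul_assoc (S.vertex x), S.vertex_mul_self, mul_assoc]

theorem d₀_relator (a : E) : S.d₀ (S.relator a) = 0 := by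
  rw [relator, LinearMap.map_sub, d₀_single, d₀_single, mul_one, one_mul, S.arrow_mul_vertex,
    S.vertex_mul_arrow, sub_self]

theorem d₀_surjective : Function.Surjective S.d₀ := by
  intro u
  refine ⟨∑ x, S.single₀ x (u ⊗ₜ[k] op 1), ?_⟩
  rw [map_sum]
  simp_rw [d₀_single, mul_one]
  rw [← Finset.mul_sum, S.sum_vertex, mul_one]

theorem single₀_tmul (x : V) (u v : Λ) :
    S.single₀ x (u ⊗ₜ[k] op v) = S.single₀ x ((u * S.vertex x) ⊗ₜ[k] op (S.vertex x * v)) := by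
  rw [← tmul_op_mul_tmul_op]
  exact (IdempotentModule.single_mul (fun x => S.bivertex_mul_self x x) x _).symm

theorem smul_relator (a : E) (u v : Λ) :
    (u ⊗ₜ[k] op v : EnvelopingAlgebra k Λ) • S.relator a =
      S.single₀ (S.src a) ((u * S.arrow a) ⊗ₜ[k] op v) -
        S.single₀ (S.tgt a) (u ⊗ₜ[k] op (S.arrow a * v)) := by
  rw [relator, smul_sub, ← LinearMap.map_smul, ← LinearMap.map_smul, smul_eq_mul, smul_eq_mul,
    tmul_op_mul_tmul_op, tmul_op_mul_tmul_op, one_mul, mul_one]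

theorem bivertex_smul_relator (a : E) :
    S.bivertex (S.tgt a) (S.src a) • S.relator a = S.relator a := by
  have h₁ := S.single₀_tmul (S.src a) (S.arrow a) 1
  have h₂ := S.single₀_tmul (S.tgt a) 1 (S.arrow a)
  rw [S.arrow_mul_vertex, mul_one] at h₁
  rw [S.vertex_mul_arrow, one_mul] at h₂
  rw [bivertex, smul_relator, S.vertex_mul_arrow, S.arrow_mul_vertex, relator, h₁, h₂]

/-- The right inverse `w ↦ ∑ x, w x ⊗ x` of the multiplication `P₀ → Λ`. -/
noncomputable def splitting (w : Λ) : S.P₀ := ∑ x, S.single₀ x (w ⊗ₜ[k] op 1)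

theorem splitting_add (w w' : Λ) : S.splitting (w + w') = S.splitting w + S.splitting w' := by
  rw [splitting, splitting, splitting, ← Finset.sum_add_distrib]
  exact Finset.sum_congr rfl fun x _ => by rw [TensorProduct.add_tmul, LinearMap.map_add]

theorem splitting_zero : S.splitting 0 = 0 := by
  rw [splitting]
  exact Finset.sum_eq_zero fun x _ => by rw [TensorProduct.zero_tmul, LinearMap.map_zero]

theorem splitting_mul_vertex (u : Λ) (x : V) :
    S.splitting (u * S.vertex x) = S.single₀ x (u ⊗ₜ[k] op 1) := by
  rw [splitting, Finset.sum_eq_single x]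
  · rw [single₀_tmul, mul_assoc, S.vertex_mul_self, ← single₀_tmul]
  · intro z _ h
    rw [single₀_tmul, mul_assoc, S.vertex_mul_of_ne _ _ h.symm, mul_zero, TensorProduct.zero_tmul,
      LinearMap.map_zero]
  · simp

theorem vertexCoeff_smul (y : V) (r : EnvelopingAlgebra k Λ) (w : Λ) :
    S.vertexCoeff y (r • w) = S.bivertexCoeff y y r * S.vertexCoeff y w := by
  induction r using TensorProduct.induction_on with
  | zero =>
    have h : (0 : EnvelopingAlgebra k Λ) • w = 0 := Module.zero_smul w
    rw [map_zero, zero_mul]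
    exact (congrArg _ h).trans (map_zero _)
  | add r s hr hs => rw [add_smul, map_add, map_add, add_mul, hr, hs]
  | tmul u v =>
    rw [← MulOpposite.op_unop v, tmul_smul, bivertexCoeff_tmul, map_mul, map_mul]
    ring

/-- The kernel of `P₀ → Λ` lies in the radical, because the vertices are linearly independent
modulo the radical of `Λ`. -/
theorem isSuperfluous_ker_d₀ : Submodule.IsSuperfluous (A := EnvelopingAlgebra k Λ) S.d₀.ker := by
  refine S.isSuperfluous_ker _ _ S.d₀ fun f hf y => ?_
  have h : S.vertexCoeff y (S.d₀ f) = S.bivertexCoeff y y (IdempotentModule.coord y f) := by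
    rw [d₀, IdempotentModule.lift_apply, map_sum, Finset.sum_eq_single y]
    · rw [vertexCoeff_smul, map_one, mul_one]
    · intro x _ hx
      rw [← IdempotentModule.coord_mul, mul_smul, vertexCoeff_smul, bivertex, tmul_smul, mul_one,
        S.vertex_mul_self, S.vertexCoeff_vertex_of_ne _ _ hx.symm, mul_zero]
    · simp
  rw [← h, hf, map_zero]

/-- The sum of the components of an element of `P₀`. -/
noncomputable def total : S.P₀ →ₗ[EnvelopingAlgebra k Λ] EnvelopingAlgebra k Λ :=
  IdempotentModule.lift (fun x => S.bivertex x x) fun _ => 1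

theorem total_relator (a : E) :
    S.total (S.relator a) = S.arrow a ⊗ₜ[k] op (S.vertex (S.src a)) -
      S.vertex (S.tgt a) ⊗ₜ[k] op (S.arrow a) := by
  rw [relator, LinearMap.map_sub, total, IdempotentModule.lift_single,
    IdempotentModule.lift_single, smul_eq_mul, smul_eq_mul, mul_one, mul_one, bivertex, bivertex,
    tmul_op_mul_tmul_op, tmul_op_mul_tmul_op, mul_one, one_mul, S.arrow_mul_vertex,
    S.vertex_mul_arrow]

theorem pairing_mul_total_relator_self (a : E) (r : EnvelopingAlgebra k Λ) :
    pairing (S.arrowCoeff a) (S.vertexCoeff (S.src a)).toLinearMap (r * S.total (S.relator a)) =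
      S.bivertexCoeff (S.tgt a) (S.src a) r := by
  rw [total_relator]
  induction r using TensorProduct.induction_on with
  | zero => rw [zero_mul, map_zero, map_zero]
  | add r s hr hs => rw [add_mul, map_add, map_add, hr, hs]
  | tmul u v =>
    rw [← MulOpposite.op_unop v, mul_sub, map_sub, tmul_op_mul_tmul_op, tmul_op_mul_tmul_op,
      pairing_tmul, pairing_tmul, bivertexCoeff_tmul, S.arrowCoeff_mul_arrow_self,
      AlgHom.toLinearMap_apply, AlgHom.toLinearMap_apply, map_mul (S.vertexCoeff _),
      map_mul (S.vertexCoeff _), S.vertexCoeff_arrow, S.vertexCoeff_vertex_self, one_mul, zero_mul,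
      mul_zero, sub_zero]

theorem pairing_mul_total_relator_of_ne {a b : E} (h : a ≠ b) (r : EnvelopingAlgebra k Λ) :
    pairing (S.arrowCoeff a) (S.vertexCoeff (S.src a)).toLinearMap
      (r * S.total (S.relator b)) = 0 := by
  rw [total_relator]
  induction r using TensorProduct.induction_on with
  | zero => rw [zero_mul, map_zero]
  | add r s hr hs => rw [add_mul, map_add, hr, hs, add_zero]
  | tmul u v =>
    rw [← MulOpposite.op_unop v, mul_sub, map_sub, tmul_op_mul_tmul_op, tmul_op_mul_tmul_op,
      pairing_tmul, pairing_tmul, S.arrowCoeff_mul_arrow_of_ne _ _ _ h,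
      AlgHom.toLinearMap_apply, AlgHom.toLinearMap_apply, map_mul (S.vertexCoeff _),
      map_mul (S.vertexCoeff _), S.vertexCoeff_arrow, zero_mul, zero_mul, mul_zero, sub_zero]

variable [Fintype E]

/-- The map `P₁ → P₀` sending `t(a) ⊗ s(a)` to `a ⊗ s(a) - t(a) ⊗ a`. -/
noncomputable def d₁ : S.P₁ →ₗ[EnvelopingAlgebra k Λ] S.P₀ :=
  IdempotentModule.lift (fun a => S.bivertex (S.tgt a) (S.src a)) S.relator

theorem relator_mem_range (a : E) : S.relator a ∈ S.d₁.range := by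
  refine ⟨IdempotentModule.single (fun a => S.bivertex_mul_self (S.tgt a) (S.src a)) a 1, ?_⟩
  rw [d₁, IdempotentModule.lift_single, one_mul, bivertex_smul_relator]

theorem d₀_d₁ (f : S.P₁) : S.d₀ (S.d₁ f) = 0 := by
  rw [d₁, IdempotentModule.lift_apply, map_sum]
  refine Finset.sum_eq_zero fun a _ => ?_
  rw [LinearMap.map_smul, d₀_relator, smul_zero]

/-- Modulo the relators, an element `u ⊗ v` of `P₀` depends only on the product `u v`: the arrows
of `v` can be moved to the left factor one at a time. -/
theorem single₀_sub_splitting_mem (v u : Λ) (x : V) :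
    S.single₀ x (u ⊗ₜ[k] op v) - S.splitting (u * S.vertex x * v) ∈ S.d₁.range := by
  let W : Submodule k Λ :=
    { carrier := {v | ∀ (u : Λ) (x : V),
        S.single₀ x (u ⊗ₜ[k] op v) - S.splitting (u * S.vertex x * v) ∈ S.d₁.range}
      add_mem' := fun {v v'} hv hv' u x => by
        rw [MulOpposite.op_add, TensorProduct.tmul_add, LinearMap.map_add, mul_add, splitting_add,
          add_sub_add_comm]
        exact Submodule.add_mem _ (hv u x) (hv' u x)
      zero_mem' := fun u x => by
        rw [MulOpposite.op_zero, TensorProduct.tmul_zero, LinearMap.map_zero, mul_zero,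
          splitting_zero, sub_zero]
        exact Submodule.zero_mem _
      smul_mem' := fun c v hv u x => by
        have := hv (c • u) x
        rwa [← TensorProduct.smul_tmul', ← TensorProduct.tmul_smul, ← MulOpposite.op_smul,
          smul_mul_assoc, smul_mul_assoc, ← mul_smul_comm] at this }
  have hW : W = ⊤ := by
    refine S.span_eq_top W (fun y u x => ?_) fun a w hw u x => ?_
    · by_cases h : x = y
      · subst h
        rw [mul_assoc, S.vertex_mul_self, splitting_mul_vertex, single₀_tmul,
          S.single₀_tmul x u 1, S.vertex_mul_self, mul_one, sub_self]
        exact Submodule.zero_mem _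
      · rw [mul_assoc, single₀_tmul, S.vertex_mul_of_ne _ _ h, mul_zero, splitting_zero,
          MulOpposite.op_zero, TensorProduct.tmul_zero, LinearMap.map_zero, sub_zero]
        exact Submodule.zero_mem _
    · by_cases h : x = S.tgt a
      · subst h
        have h₁ := hw (u * S.arrow a) (S.src a)
        have h₂ := S.d₁.range.smul_mem (u ⊗ₜ[k] op w) (S.relator_mem_range a)
        have h₃ := Submodule.sub_mem _ h₁ h₂
        rw [smul_relator, mul_assoc u, S.arrow_mul_vertex, sub_sub_sub_cancel_left] at h₃
        rwa [← mul_assoc, mul_assoc u, S.vertex_mul_arrow]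
      · rw [single₀_tmul, ← mul_assoc, ← mul_assoc, mul_assoc u, S.vertex_mul_arrow_of_ne h,
          mul_zero, zero_mul, splitting_zero, MulOpposite.op_zero,
          TensorProduct.tmul_zero, LinearMap.map_zero, sub_zero]
        exact Submodule.zero_mem _
  exact hW.ge (Submodule.mem_top : v ∈ ⊤) u x

theorem sub_splitting_mem (f : S.P₀) : f - S.splitting (S.d₀ f) ∈ S.d₁.range := by
  have key : ∀ (x : V) (r : EnvelopingAlgebra k Λ),
      S.single₀ x r - S.splitting (S.d₀ (S.single₀ x r)) ∈ S.d₁.range := by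
    intro x r
    induction r using TensorProduct.induction_on with
    | zero =>
      rw [LinearMap.map_zero, LinearMap.map_zero, splitting_zero, sub_zero]
      exact Submodule.zero_mem _
    | add r s hr hs =>
      rw [LinearMap.map_add, LinearMap.map_add, splitting_add, add_sub_add_comm]
      exact Submodule.add_mem _ hr hs
    | tmul u v =>
      rw [← MulOpposite.op_unop v, d₀_single]
      exact S.single₀_sub_splitting_mem _ _ _
  have hs : ∀ (s : Finset V) (g : V → S.P₀), (∀ x, g x - S.splitting (S.d₀ (g x)) ∈ S.d₁.range) →
      ∑ x ∈ s, g x - S.splitting (S.d₀ (∑ x ∈ s, g x)) ∈ S.d₁.range := by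
    classical
    intro s g hg
    induction s using Finset.induction_on with
    | empty =>
      rw [Finset.sum_empty, LinearMap.map_zero, splitting_zero, sub_zero]
      exact Submodule.zero_mem _
    | insert x s hx ih =>
      rw [Finset.sum_insert hx, LinearMap.map_add, splitting_add, add_sub_add_comm]
      exact Submodule.add_mem _ (hg x) ih
  rw [IdempotentModule.eq_sum_single (fun x => S.bivertex_mul_self x x) f]
  exact hs _ _ fun x => key x _

theorem exact_d₁_d₀ : Function.Exact S.d₁ S.d₀ := by
  refine fun f => ⟨fun hf => ?_, ?_⟩
  · have := S.sub_splitting_mem f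
    rwa [hf, splitting_zero, sub_zero] at this
  · rintro ⟨g, rfl⟩
    exact S.d₀_d₁ g

/-- The kernel of `P₁ → P₀` lies in the radical, because the arrows are linearly independent
modulo the square of the radical of `Λ`. -/
theorem isSuperfluous_ker_d₁ : Submodule.IsSuperfluous (A := EnvelopingAlgebra k Λ) S.d₁.ker := by
  refine S.isSuperfluous_ker _ _ S.d₁ fun f hf a => ?_
  have h : pairing (S.arrowCoeff a) (S.vertexCoeff (S.src a)).toLinearMap (S.total (S.d₁ f)) =
      S.bivertexCoeff (S.tgt a) (S.src a) (IdempotentModule.coord a f) := by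
    rw [d₁, IdempotentModule.lift_apply, map_sum, map_sum, Finset.sum_eq_single a]
    · rw [LinearMap.map_smul, smul_eq_mul, pairing_mul_total_relator_self]
    · intro b _ hb
      rw [LinearMap.map_smul, smul_eq_mul, S.pairing_mul_total_relator_of_ne hb.symm]
    · simp
  rw [← h, hf, LinearMap.map_zero, map_zero]

end BoundQuiverStructure

end StandardPresentation

/-! ### The dimension formula for a bound quiver algebra -/

section Dimension

universe l

open MulOpposite (op unop)
open EnvelopingAlgebra

namespace BoundQuiverStructure

variable {k : Type u} [Field k]

/-- A bound quiver algebra is finite dimensional, since `Λ = G + G Λ` for the span `G` of the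
vertices and arrows, and the arrows lie in a nilpotent ideal. -/
theorem finite {Λ : Type l} [Ring Λ] [Algebra k Λ] {V : Type v} {E : Type w} [Fintype V]
    [Fintype E] (S : BoundQuiverStructure k Λ V E) : Module.Finite k Λ := by
  have := S.isTwoSided_rad
  let G : Submodule k Λ := Submodule.span k (Set.range S.vertex ∪ Set.range S.arrow)
  have hG : G.FG := Submodule.fg_span ((Set.finite_range _).union (Set.finite_range _))
  have hv : ∀ x, S.vertex x ∈ G := fun x => Submodule.subset_span (Or.inl ⟨x, rfl⟩)
  have ha : ∀ a, S.arrow a ∈ G := fun a => Submodule.subset_span (Or.inr ⟨a, rfl⟩)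
  have key : ∀ j : ℕ, ∃ U : Submodule k Λ, U.FG ∧ U ⊔ (S.rad ^ j).restrictScalars k = ⊤ := by
    intro j
    induction j with
    | zero =>
      refine ⟨⊥, Submodule.fg_bot, ?_⟩
      rw [Submodule.pow_zero, Ideal.one_eq_top, Submodule.restrictScalars_top, sup_top_eq]
    | succ j ih =>
      obtain ⟨U, hU, hUj⟩ := ih
      refine ⟨G ⊔ G * U, hG.sup (hG.mul hU), S.span_eq_top _ (fun x => ?_) fun a w _ => ?_⟩
      · exact Submodule.mem_sup_left (Submodule.mem_sup_left (hv x))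
      · obtain ⟨y, hy, r, hr, rfl⟩ := Submodule.mem_sup.1 (hUj.ge (Submodule.mem_top : w ∈ ⊤))
        rw [mul_add, Ideal.IsTwoSided.pow_succ]
        exact Submodule.add_mem_sup (Submodule.mem_sup_right (Submodule.mul_mem_mul (ha a) hy))
          (Ideal.mul_mem_mul (S.arrow_mem_rad a) hr)
  obtain ⟨n, hn⟩ := S.rad_nilpotent
  obtain ⟨U, hU, hUn⟩ := key n
  rw [hn, Submodule.restrictScalars_bot, sup_bot_eq] at hUn
  exact ⟨hUn ▸ hU⟩

theorem finrank_hom_bivertex {Λ : Type l} [Ring Λ] [Algebra k Λ] [Module.Finite k Λ] {V : Type v}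
    {E : Type w} [Fintype V] (S : BoundQuiverStructure k Λ V E) {ι : Type p} [Fintype ι]
    (y x : ι → V) :
    Module.finrank k (IdempotentModule (fun i => S.bivertex (y i) (x i))
      →ₗ[EnvelopingAlgebra k Λ] Λ) =
      ∑ i, Module.finrank k (cornerSubspace k (S.vertex (y i)) (S.vertex (x i))) := by
  rw [IdempotentModule.finrank_hom Λ k fun i => S.bivertex_mul_self (y i) (x i)]
  refine Finset.sum_congr rfl fun i _ => ?_
  rw [bivertex, range_lsmul_tmul]

variable {V : Type v} {E : Type w} [Fintype V] [Fintype E]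
variable {Λ : Type (max l v w)} [Ring Λ] [Algebra k Λ] (S : BoundQuiverStructure k Λ V E)

/-- The minimal projective presentation `P₁ → P₀ → Λ → 0` of the bimodule `Λ`. -/
noncomputable def presentation :
    MinimalProjectivePresentation.{max l v w, max l v w, max l v w} (EnvelopingAlgebra k Λ) Λ where
  P₁ := S.P₁
  P₀ := S.P₀
  finite₁ := IdempotentModule.finite fun _ => S.bivertex_mul_self _ _
  finite₀ := IdempotentModule.finite fun _ => S.bivertex_mul_self _ _
  projective₁ := IdempotentModule.projective fun _ => S.bivertex_mul_self _ _
  projective₀ := IdempotentModule.projective fun _ => S.bivertex_mul_self _ _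
  d₁ := S.d₁
  d₀ := S.d₀
  surjective := S.d₀_surjective
  exact := S.exact_d₁_d₀
  superfluous₀ := S.isSuperfluous_ker_d₀
  superfluous₁ := S.isSuperfluous_ker_d₁

theorem finrank_tauHochschild
    (Pr : MinimalProjectivePresentation.{max l v w, max l v w, p} (EnvelopingAlgebra k Λ) Λ) :
    Module.Finite k (TauHochschild k Λ Pr Λ) ∧
    (Module.finrank k (TauHochschild k Λ Pr Λ) : ℤ) =
      (Module.finrank k (Subalgebra.center k Λ) : ℤ)
      - ∑ x : V, (Module.finrank k (cornerSubspace k (S.vertex x) (S.vertex x)) : ℤ)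
      + ∑ a : E, (Module.finrank k
          (cornerSubspace k (S.vertex (S.tgt a)) (S.vertex (S.src a))) : ℤ) := by
  have := S.finite
  obtain ⟨⟨g₁⟩, ⟨g₀⟩⟩ := Pr.nonempty_linearEquiv
    (BoundQuiverStructure.presentation.{u, v, w, l} S)
  have e₁ : (S.P₁ →ₗ[EnvelopingAlgebra k Λ] Λ) ≃ₗ[k] (Pr.P₁ →ₗ[EnvelopingAlgebra k Λ] Λ) :=
    (g₁.congrLeft Λ k).symm
  have e₀ : (S.P₀ →ₗ[EnvelopingAlgebra k Λ] Λ) ≃ₗ[k] (Pr.P₀ →ₗ[EnvelopingAlgebra k Λ] Λ) :=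
    (g₀.congrLeft Λ k).symm
  have f₁ : Module.Finite k (S.P₁ →ₗ[EnvelopingAlgebra k Λ] Λ) :=
    IdempotentModule.finite_hom Λ k fun _ => S.bivertex_mul_self _ _
  have f₀ : Module.Finite k (S.P₀ →ₗ[EnvelopingAlgebra k Λ] Λ) :=
    IdempotentModule.finite_hom Λ k fun _ => S.bivertex_mul_self _ _
  have := Module.Finite.equiv e₁
  have := Module.Finite.equiv e₀
  obtain ⟨hfin, hrank⟩ := finrank_tauHom k Pr Λ
  refine ⟨inferInstance, ?_⟩
  rw [Subspace.dual_finrank_eq, hrank, endEquivCenter.finrank_eq, ← e₀.finrank_eq,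
    ← e₁.finrank_eq, S.finrank_hom_bivertex S.tgt S.src,
    S.finrank_hom_bivertex (fun x => x) (fun x => x), Nat.cast_sum, Nat.cast_sum]

end BoundQuiverStructure

end Dimension

/-! ### Coefficients in the path algebra -/

section PathCoefficients

namespace OrientedPath

variable {V : Type v} [Quiver.{w} V]

/-- The number of arrows of a path. -/
def length (p : OrientedPath V) : ℕ := p.path.length

theorem length_trivial (x : V) : (trivial x).length = 0 := rfl

theorem length_ofArrow {x y : V} (a : x ⟶ y) : (ofArrow a).length = 1 := rfl

theorem eq_trivial_of_length_eq_zero {p : OrientedPath V} (h : p.length = 0) :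
    p = trivial p.source := by
  obtain ⟨x, y, p⟩ := p
  cases p with
  | nil => rfl
  | cons p a => exact absurd h (Nat.succ_ne_zero _)

theorem length_comp {p q r : OrientedPath V} (h : comp p q = some r) :
    r.length = p.length + q.length := by
  obtain ⟨ps, pt, p⟩ := p
  obtain ⟨qs, qt, q⟩ := q
  by_cases hpq : qt = ps
  · subst hpq
    simp only [comp, dite_true, Option.some.injEq] at h
    rw [← h]
    exact (Quiver.Path.length_comp _ _).trans (add_comm _ _)
  · simp [comp, hpq] at h

theorem comp_ofArrow_left {x y z : V} (p : Quiver.Path x y) (a : y ⟶ z) :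
    comp (ofArrow a) ⟨x, y, p⟩ = some ⟨x, z, p.cons a⟩ := by
  simp [comp, ofArrow]

theorem trivial_injective : Function.Injective (trivial (V := V)) := fun _ _ h =>
  congrArg source h

theorem ofArrow_injective :
    Function.Injective fun a : (Σ x y : V, x ⟶ y) => ofArrow a.2.2 := by
  rintro ⟨x, y, a⟩ ⟨x', y', b⟩ h
  simp only [ofArrow, OrientedPath.mk.injEq] at h
  obtain ⟨rfl, rfl, h⟩ := h
  rw [Quiver.Path.hom_heq_of_cons_eq_cons (eq_of_heq h) |> eq_of_heq]

end OrientedPath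

namespace PathAlgebra

open OrientedPath

variable {k : Type u} [Field k] {V : Type v} [Quiver.{w} V]

/-- The coefficient of an oriented path in an element of `kQ`. -/
noncomputable def coeff (p : OrientedPath V) : PathAlgebra k V →ₗ[k] k := pathBasis.coord p

theorem coeff_ofPath_self (p : OrientedPath V) : coeff p (ofPath p : PathAlgebra k V) = 1 :=
  Finsupp.single_eq_same

theorem coeff_ofPath_of_ne {p q : OrientedPath V} (h : p ≠ q) :
    coeff p (ofPath q : PathAlgebra k V) = 0 :=
  Finsupp.single_eq_of_ne h

theorem coeff_ofPath_of_length_ne {p q : OrientedPath V} (h : p.length ≠ q.length) :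
    coeff p (ofPath q : PathAlgebra k V) = 0 :=
  coeff_ofPath_of_ne fun hpq => h (congrArg length hpq)

theorem coeff_ofPath_mul_of_length {p q r : OrientedPath V} (h : r.length ≠ p.length + q.length) :
    coeff r (ofPath p * ofPath q : PathAlgebra k V) = 0 := by
  rw [ofPath_mul_ofPath]
  cases hc : comp p q with
  | none => exact map_zero _
  | some s =>
    refine coeff_ofPath_of_length_ne fun hr => h (hr.trans (length_comp hc))

/-- The coefficient of a trivial path at `x` in a product. -/
theorem coeff_trivial_mul (x : V) (f g : PathAlgebra k V) :
    coeff (trivial x) (f * g) = coeff (trivial x) f * coeff (trivial x) g := by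
  classical
  induction f using induction_on with
  | zero => rw [zero_mul, map_zero, zero_mul]
  | add f f' hf hf' => rw [add_mul, map_add, map_add, add_mul, hf, hf']
  | smul c f hf =>
    rw [show c • f * g = c • (f * g) by simp [mul_def], map_smul, map_smul, hf, smul_mul_assoc]
  | path p =>
    induction g using induction_on with
    | zero => rw [mul_zero, map_zero, mul_zero]
    | add g g' hg hg' => rw [mul_add, map_add, map_add, mul_add, hg, hg']
    | smul c g hg =>
      rw [show ofPath p * c • g = c • (ofPath p * g) by simp [mul_def], map_smul, map_smul, hg,
        mul_smul_comm]
    | path q =>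
      by_cases hp : p.length = 0
      · rw [eq_trivial_of_length_eq_zero hp]
        generalize p.source = y
        rw [ofPath_mul_ofPath, trivial_comp]
        by_cases hq : trivial x = q
        · subst hq
          by_cases hxy : x = y
          · subst hxy
            rw [if_pos (show (trivial x).target = x from rfl), Option.elim_some,
              coeff_ofPath_self, mul_one]
          · rw [if_neg (show ¬(trivial x).target = y from hxy), Option.elim_none, map_zero,
              coeff_ofPath_of_ne fun h => hxy (trivial_injective h), zero_mul]
        · rw [coeff_ofPath_of_ne hq, mul_zero]
          split_ifs
          · exact coeff_ofPath_of_ne hq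
          · exact map_zero _
      · rw [coeff_ofPath_of_length_ne (q := p) (by rw [length_trivial]; omega), zero_mul,
          coeff_ofPath_mul_of_length (by rw [length_trivial]; omega)]

/-- The Leibniz rule for the coefficient of an arrow. -/
theorem coeff_ofArrow_mul {x y : V} (a : x ⟶ y) (f g : PathAlgebra k V) :
    coeff (ofArrow a) (f * g) = coeff (trivial y) f * coeff (ofArrow a) g +
      coeff (ofArrow a) f * coeff (trivial x) g := by
  classical
  induction f using induction_on with
  | zero => simp only [zero_mul, map_zero, add_zero]
  | add f f' hf hf' => rw [add_mul, map_add, map_add, map_add, hf, hf']; ring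
  | smul c f hf =>
    rw [show c • f * g = c • (f * g) by simp [mul_def], map_smul, map_smul, map_smul, hf]
    simp only [smul_eq_mul]
    ring
  | path p =>
    induction g using induction_on with
    | zero => simp only [mul_zero, map_zero, add_zero]
    | add g g' hg hg' => rw [mul_add, map_add, map_add, map_add, hg, hg']; ring
    | smul c g hg =>
      rw [show ofPath p * c • g = c • (ofPath p * g) by simp [mul_def], map_smul, map_smul,
        map_smul, hg]
      simp only [smul_eq_mul]
      ring
    | path q =>
      by_cases hp : p.length = 0
      · rw [eq_trivial_of_length_eq_zero hp]
        generalize p.source = z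
        rw [ofPath_mul_ofPath, trivial_comp,
          coeff_ofPath_of_length_ne (p := ofArrow a) (q := trivial z) (Nat.succ_ne_zero 0),
          zero_mul, add_zero]
        by_cases hq : ofArrow a = q
        · subst hq
          by_cases hyz : y = z
          · subst hyz
            rw [if_pos (show (ofArrow a).target = y from rfl), Option.elim_some, coeff_ofPath_self,
              coeff_ofPath_self, mul_one]
          · rw [if_neg (show ¬(ofArrow a).target = z from hyz), Option.elim_none, map_zero,
              coeff_ofPath_of_ne fun h => hyz (trivial_injective h), zero_mul]
        · rw [coeff_ofPath_of_ne hq, mul_zero]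
          split_ifs
          · exact coeff_ofPath_of_ne hq
          · exact map_zero _
      · rw [coeff_ofPath_of_length_ne (p := trivial y) (q := p) (by rw [length_trivial]; omega),
          zero_mul, zero_add]
        by_cases hq : q.length = 0
        · rw [eq_trivial_of_length_eq_zero hq]
          generalize q.source = z
          rw [ofPath_mul_ofPath, comp_trivial]
          by_cases hp' : ofArrow a = p
          · subst hp'
            by_cases hxz : x = z
            · subst hxz
              rw [if_pos (show x = (ofArrow a).source from rfl), Option.elim_some,
                coeff_ofPath_self, coeff_ofPath_self, mul_one]
            · rw [if_neg (show ¬z = (ofArrow a).source from Ne.symm hxz), Option.elim_none,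
                map_zero, coeff_ofPath_of_ne (q := trivial z) fun h => hxz (trivial_injective h),
                mul_zero]
          · rw [coeff_ofPath_of_ne hp', zero_mul]
            split_ifs
            · exact coeff_ofPath_of_ne hp'
            · exact map_zero _
        · rw [coeff_ofPath_of_length_ne (p := trivial x) (q := q)
              (by rw [length_trivial]; omega), mul_zero,
            coeff_ofPath_mul_of_length (by rw [length_ofArrow]; omega)]

theorem arrow_mul_ofPath {x y z : V} (p : Quiver.Path x y) (a : y ⟶ z) :
    (arrow a * ofPath ⟨x, y, p⟩ : PathAlgebra k V) = ofPath ⟨x, z, p.cons a⟩ := by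
  rw [arrow, ofPath_mul_ofPath, comp_ofArrow_left, Option.elim_some]

theorem vertex_mul_vertex_self (x : V) : (vertex x * vertex x : PathAlgebra k V) = vertex x := by
  classical
  rw [vertex, ofPath_mul_ofPath, trivial_comp,
    if_pos (show (trivial x).target = x from rfl), Option.elim_some]

theorem vertex_mul_vertex_of_ne {x y : V} (h : x ≠ y) :
    (vertex x * vertex y : PathAlgebra k V) = 0 := by
  classical
  rw [vertex, vertex, ofPath_mul_ofPath, trivial_comp,
    if_neg (show ¬(trivial y).target = x from h.symm), Option.elim_none]

theorem vertex_mul_arrow {x y : V} (a : x ⟶ y) :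
    (vertex y * arrow a : PathAlgebra k V) = arrow a := by
  classical
  rw [vertex, arrow, ofPath_mul_ofPath, trivial_comp,
    if_pos (show (ofArrow a).target = y from rfl), Option.elim_some]

theorem arrow_mul_vertex {x y : V} (a : x ⟶ y) :
    (arrow a * vertex x : PathAlgebra k V) = arrow a := by
  classical
  rw [vertex, arrow, ofPath_mul_ofPath, comp_trivial,
    if_pos (show x = (ofArrow a).source from rfl), Option.elim_some]

variable [Fintype V]

/-- The algebra homomorphism `kQ → k` sending the vertex `x` to `1` and all other vertices and
all arrows to `0`. -/
noncomputable def vertexCoeff (x : V) : PathAlgebra k V →ₐ[k] k :=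
  AlgHom.ofLinearMap (coeff (trivial x))
    (by
      rw [one_def, map_sum, Finset.sum_eq_single x]
      · exact coeff_ofPath_self _
      · exact fun y _ h => coeff_ofPath_of_ne fun h' => h (trivial_injective h').symm
      · simp)
    (coeff_trivial_mul x)

theorem arrow_mem_arrowIdeal {x y : V} (a : x ⟶ y) : arrow a ∈ arrowIdeal k V :=
  TwoSidedIdeal.mem_asIdeal.2 (TwoSidedIdeal.subset_span ⟨x, y, a, rfl⟩)

instance : (arrowIdeal k V).IsTwoSided := by
  rw [arrowIdeal]
  infer_instance

theorem coeff_trivial_of_mem_arrowIdeal (x : V) {f : PathAlgebra k V} (hf : f ∈ arrowIdeal k V) :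
    coeff (trivial x) f = 0 := by
  have h : TwoSidedIdeal.span {f : PathAlgebra k V | ∃ (x y : V) (a : x ⟶ y), f = arrow a} ≤
      TwoSidedIdeal.ker (vertexCoeff (k := k) x) := by
    rw [TwoSidedIdeal.span_le]
    rintro _ ⟨y, z, a, rfl⟩
    exact (TwoSidedIdeal.mem_ker _).2 (coeff_ofPath_of_length_ne (Nat.succ_ne_zero 0).symm)
  exact (TwoSidedIdeal.mem_ker (vertexCoeff x)).1 (h (TwoSidedIdeal.mem_asIdeal.1 hf))

theorem arrowIdeal_sq_le : arrowIdeal k V ^ 2 ≤ arrowIdeal k V * arrowIdeal k V := by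
  rw [Submodule.pow_succ, Submodule.pow_one]

theorem coeff_trivial_of_mem_sq (x : V) {f : PathAlgebra k V} (hf : f ∈ arrowIdeal k V ^ 2) :
    coeff (trivial x) f = 0 :=
  coeff_trivial_of_mem_arrowIdeal x (Ideal.mul_le_left (arrowIdeal_sq_le hf))

theorem coeff_ofArrow_of_mem_sq {x y : V} (a : x ⟶ y) {f : PathAlgebra k V}
    (hf : f ∈ arrowIdeal k V ^ 2) : coeff (ofArrow a) f = 0 := by
  replace hf : f ∈ arrowIdeal k V * arrowIdeal k V := arrowIdeal_sq_le hf
  induction hf using Submodule.mul_induction_on' with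
  | mem_mul_mem g hg g' hg' =>
    rw [coeff_ofArrow_mul, coeff_trivial_of_mem_arrowIdeal y hg,
      coeff_trivial_of_mem_arrowIdeal x hg', zero_mul, mul_zero, add_zero]
  | add g _ g' _ hg hg' => rw [map_add, hg, hg', add_zero]

end PathAlgebra

end PathCoefficients

/-! ### The quotient by an admissible ideal -/

section BoundQuiver

theorem Ideal.map_pow_le_of_surjective {R : Type u} {T : Type v} [Ring R] [Ring T] (f : R →+* T)
    (hf : Function.Surjective f) (J : Ideal R) (n : ℕ) : J.map f ^ n ≤ (J ^ n).map f := by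
  induction n with
  | zero =>
    rw [Submodule.pow_zero, Submodule.pow_zero, Ideal.one_eq_top, Ideal.one_eq_top, Ideal.map_top]
  | succ n ih =>
    rw [Submodule.pow_succ, Submodule.pow_succ]
    refine (Ideal.mul_mono ih le_rfl).trans (Ideal.mul_le.2 fun r hr s hs => ?_)
    obtain ⟨r, hr', rfl⟩ := (Ideal.mem_map_iff_of_surjective f hf).1 hr
    obtain ⟨s, hs', rfl⟩ := (Ideal.mem_map_iff_of_surjective f hf).1 hs
    rw [← map_mul]
    exact Ideal.mem_map_of_mem f (Ideal.mul_mem_mul hr' hs')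

theorem Ideal.isTwoSided_map_of_surjective {R : Type u} {T : Type v} [Ring R] [Ring T]
    (f : R →+* T) (hf : Function.Surjective f) (J : Ideal R) [J.IsTwoSided] :
    (J.map f).IsTwoSided where
  mul_mem_of_left {r} t hr := by
    obtain ⟨r, hr', rfl⟩ := (Ideal.mem_map_iff_of_surjective f hf).1 hr
    obtain ⟨t, rfl⟩ := hf t
    rw [← map_mul]
    exact Ideal.mem_map_of_mem f (J.mul_mem_right t hr')

open PathAlgebra OrientedPath in
/-- The quotient of the path algebra by an admissible ideal. The linear forms are the coefficients
of the vertices and arrows, which vanish on `F ^ 2`, hence on the ideal. -/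
noncomputable def BoundQuiverAlgebra.boundQuiverStructure {k : Type u} [Field k] {V : Type v}
    [Quiver.{w} V] [Fintype V] (I : Ideal (PathAlgebra k V)) [I.IsTwoSided] (hI : PathAlgebra.IsAdmissible I) :
    BoundQuiverStructure k (BoundQuiverAlgebra k V I) V (Σ x y : V, x ⟶ y) where
  src a := a.1
  tgt a := a.2.1
  vertex := BoundQuiverAlgebra.vertex I
  arrow a := Ideal.Quotient.mk I (arrow a.2.2)
  vertex_mul_self x := by
    rw [BoundQuiverAlgebra.vertex, ← map_mul, vertex_mul_vertex_self]
  vertex_mul_of_ne x y h := by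
    rw [BoundQuiverAlgebra.vertex, BoundQuiverAlgebra.vertex, ← map_mul,
      vertex_mul_vertex_of_ne h, map_zero]
  sum_vertex := by
    simp only [BoundQuiverAlgebra.vertex]
    rw [← map_sum, ← one_def, map_one]
  vertex_mul_arrow a := by
    rw [BoundQuiverAlgebra.vertex, ← map_mul, PathAlgebra.vertex_mul_arrow]
  arrow_mul_vertex a := by
    rw [BoundQuiverAlgebra.vertex, ← map_mul, PathAlgebra.arrow_mul_vertex]
  span_eq_top W hv ha := by
    have hpath : ∀ (x y : V) (p : Quiver.Path x y),
        Ideal.Quotient.mk I (ofPath ⟨x, y, p⟩) ∈ W := by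
      intro x y p
      induction p with
      | nil => exact hv x
      | cons p a ih =>
        rw [← arrow_mul_ofPath, map_mul]
        exact ha ⟨_, _, a⟩ _ ih
    refine eq_top_iff.2 fun f _ => ?_
    obtain ⟨f, rfl⟩ := Ideal.Quotient.mk_surjective f
    induction f using PathAlgebra.induction_on with
    | path p => exact hpath _ _ _
    | zero => rw [map_zero]; exact W.zero_mem
    | add f g hf hg => rw [map_add]; exact W.add_mem (hf trivial) (hg trivial)
    | smul c f hf => exact W.smul_mem c (hf trivial)
  rad := (arrowIdeal k V).map (Ideal.Quotient.mk I)
  isTwoSided_rad := Ideal.isTwoSided_map_of_surjective _ Ideal.Quotient.mk_surjective _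
  arrow_mem_rad a := Ideal.mem_map_of_mem _ (arrow_mem_arrowIdeal _)
  rad_nilpotent := by
    obtain ⟨n, -, hn, -⟩ := hI
    refine ⟨n, eq_bot_iff.2 ((Ideal.map_pow_le_of_surjective _ Ideal.Quotient.mk_surjective _
      n).trans ((Ideal.map_mono hn).trans ?_))⟩
    rw [Ideal.map_quotient_self]
  vertexCoeff x := Ideal.Quotient.liftₐ I (PathAlgebra.vertexCoeff x) fun f hf => by
    obtain ⟨n, -, -, hI⟩ := hI
    exact coeff_trivial_of_mem_sq x (hI hf)
  vertexCoeff_vertex_self x := coeff_ofPath_self _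
  vertexCoeff_vertex_of_ne x y h := coeff_ofPath_of_ne fun h' => h (trivial_injective h')
  vertexCoeff_arrow x a := coeff_ofPath_of_length_ne (Nat.succ_ne_zero 0).symm
  arrowCoeff a :=
    (I.restrictScalars k).liftQ (coeff (ofArrow a.2.2)) fun f hf => by
      obtain ⟨n, -, -, hI⟩ := hI
      exact coeff_ofArrow_of_mem_sq _ (hI hf)
  arrowCoeff_mul_arrow_self a u := by
    obtain ⟨f, rfl⟩ := Ideal.Quotient.mk_surjective u
    refine (coeff_ofArrow_mul a.2.2 f (arrow a.2.2)).trans ?_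
    rw [arrow, coeff_ofPath_self, mul_one,
      coeff_ofPath_of_length_ne (p := trivial a.1) (q := ofArrow a.2.2) (Nat.succ_ne_zero 0).symm,
      mul_zero, add_zero]
    rfl
  arrowCoeff_mul_arrow_of_ne a b u h := by
    obtain ⟨f, rfl⟩ := Ideal.Quotient.mk_surjective u
    refine (coeff_ofArrow_mul a.2.2 f (arrow b.2.2)).trans ?_
    rw [arrow, coeff_ofPath_of_ne fun h' => h (ofArrow_injective h'), mul_zero, zero_add,
      coeff_ofPath_of_length_ne (p := trivial a.1) (q := ofArrow b.2.2) (Nat.succ_ne_zero 0).symm,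
      mul_zero]

end BoundQuiver

theorem mainTheorem3 (k : Type u) [Field k] (V : Type v) [Quiver.{w} V] [Fintype V]
    [∀ x y : V, Fintype (x ⟶ y)]
    (I : Ideal (PathAlgebra k V)) [I.IsTwoSided] (hI : PathAlgebra.IsAdmissible I) :
    Module.Finite k (BoundQuiverAlgebra k V I) ∧
    Nonempty (MinimalProjectivePresentation.{max u v w, max u v w, max u v w}
      (EnvelopingAlgebra k (BoundQuiverAlgebra k V I)) (BoundQuiverAlgebra k V I)) ∧
    ∀ Pr : MinimalProjectivePresentation.{max u v w, max u v w, p}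
        (EnvelopingAlgebra k (BoundQuiverAlgebra k V I)) (BoundQuiverAlgebra k V I),
      Module.Finite k (TauHochschild k (BoundQuiverAlgebra k V I) Pr (BoundQuiverAlgebra k V I)) ∧
      (Module.finrank k
          (TauHochschild k (BoundQuiverAlgebra k V I) Pr (BoundQuiverAlgebra k V I)) : ℤ) =
        (Module.finrank k (Subalgebra.center k (BoundQuiverAlgebra k V I)) : ℤ)
        - ∑ x : V, (Module.finrank k (cornerSubspace k (BoundQuiverAlgebra.vertex I x)
            (BoundQuiverAlgebra.vertex I x)) : ℤ)
        + ∑ x : V, ∑ y : V, ∑ _a : (x ⟶ y), (Module.finrank k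
            (cornerSubspace k (BoundQuiverAlgebra.vertex I y) (BoundQuiverAlgebra.vertex I x)) : ℤ) := by
  let S := BoundQuiverAlgebra.boundQuiverStructure I hI
  refine ⟨S.finite, ⟨BoundQuiverStructure.presentation.{u, v, max v w, u} S⟩, fun Pr => ?_⟩
  obtain ⟨hfin, hrank⟩ := BoundQuiverStructure.finrank_tauHochschild.{u, v, max v w, p, u} S Pr
  refine ⟨hfin, hrank.trans (congrArg _ ?_)⟩
  rw [Fintype.sum_sigma]
  exact Finset.sum_congr rfl fun x _ => Fintype.sum_sigma _
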